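/- For $\tau\in\mathbb C^\times$ let $\mathrm{TL}(\tau)$ be the Temperley–Lieb category: its objects are $0,1,2,\dots$; $\mathrm{Hom}(m,n)$ is the complex vector space with basis the $(m,n)$-diagrams, that is, the non-crossing pairings of $m$ points on the top edge and $n$ points on the bottom edge of a rectangle; diagrams are composed by stacking, each closed loop being replaced by the factor $d=\tau+\tau^{-1}$; and the tensor product is horizontal juxtaposition. Write $T_n(\tau)=\mathrm{Hom}(n,n)$, and let $\mathrm{Tr}:T_n(\tau)\to\mathbb C$ be the Markov trace, which sends a diagram to $d^{c}$, where $c$ is the number of closed loops obtained by joining each top point to the bottom point below it outside the rectangle. A morphism $a\in\mathrm{Hom}(m,n)$ is negligible if $\mathrm{Tr}(a\circ b)=0$ for all $b\in\mathrm{Hom}(n,m)$. An ideal is a family of subspaces of the spaces $\mathrm{Hom}(m,n)$ that is closed under composition and tensor product, on either side, with arbitrary morphisms. Let $p_{[n]}$ be the generic Jones–Wenzl idempotent in the algebra $T_n$ over $\mathbb C(t)$ with loop value $t+t^{-1}$: $p_{[0]}=1_0$, $p_{[1]}=1_1$, and $$p_{[n+1]}=p_{[n]}\otimes 1_1-\frac{[n]}{[n+1]}\,(p_{[n]}\otimes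 1_1)\,e_n\,(p_{[n]}\otimes 1_1)\qquad(n\ge 1),$$ where $[k]=(t^k-t^{-k})/(t-t^{-1})$ and $e_n\in T_{n+1}$ is the diagram with $n-1$ vertical strands followed by a cup and a cap. **Proposition.** Let $\ell\ge 3$ and let $\tau\in\mathbb C$ be such that $\tau^2$ is a primitive $\ell$-th root of unity. Then the coefficients of $p_{[\ell-1]}$ have no pole at $t=\tau$, its evaluation $p_{[\ell-1]}(\tau)\in T_{\ell-1}(\tau)$ is an idempotent, and the ideal of $\mathrm{TL}(\tau)$ generated by $p_{[\ell-1]}(\tau)$ is exactly the ideal of negligible morphisms: for all $m,n$, its component in $\mathrm{Hom}(m,n)$ is the space of all negligible morphisms from $m$ to $n$. -/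

import Mathlib

namespace TemperleyLieb

/-! ### Diagrams -/

/-- The place of a marked point when the boundary of the rectangle is traversed once, starting at
the top left corner: the `m` top points from left to right, then the `n` bottom points from right
to left. -/
def pos {m n : ℕ} : Fin m ⊕ Fin n → ℕ
  | Sum.inl i => i
  | Sum.inr j => m + (n - 1 - j)

/-- An `(m, n)`-diagram up to equivalence: a pairing of the `m` top points `Sum.inl i` and the `n`
bottom points `Sum.inr j` (an equivalence relation all of whose classes have two elements) which
can be drawn in the rectangle without crossings. -/
@[ext]
structure Diagram (m n : ℕ) where
  rel : Setoid (Fin m ⊕ Fin n)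
  pairing : ∀ x, ∃! y, y ≠ x ∧ rel x y
  noncrossing : ∀ w x y z, pos w < pos x → pos x < pos y → pos y < pos z →
    rel w y → rel x z → False

theorem pos_injective {m n : ℕ} : Function.Injective (pos (m := m) (n := n)) := by
  rintro (i | i) (j | j) h <;> simp only [pos] at h
  · congr 1; ext; exact h
  · have := i.2; omega
  · have := j.2; omega
  · have := i.2; have := j.2; congr 1; ext; omega

namespace Diagram

variable {l m n : ℕ}

theorem eq_of_rel (a : Diagram m n) {x y z : Fin m ⊕ Fin n} (hxy : a.rel x y) (hxz : a.rel x z)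
    (hy : y ≠ x) (hz : z ≠ x) : y = z := by
  obtain ⟨w, _, hu⟩ := a.pairing x
  exact (hu y ⟨hy, hxy⟩).trans (hu z ⟨hz, hxz⟩).symm

/-- The other end of the strand starting at `x`. -/
noncomputable def partner (a : Diagram m n) (x : Fin m ⊕ Fin n) : Fin m ⊕ Fin n :=
  Classical.choose (a.pairing x)

theorem partner_ne (a : Diagram m n) (x) : a.partner x ≠ x :=
  (Classical.choose_spec (a.pairing x)).1.1

theorem rel_partner (a : Diagram m n) (x) : a.rel x (a.partner x) :=
  (Classical.choose_spec (a.pairing x)).1.2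

theorem eq_partner (a : Diagram m n) {x y} (h : a.rel x y) (hy : y ≠ x) : y = a.partner x :=
  a.eq_of_rel h (a.rel_partner x) hy (a.partner_ne x)

theorem partner_partner (a : Diagram m n) (x) : a.partner (a.partner x) = x :=
  (a.eq_partner (a.rel.symm (a.rel_partner x)) (a.partner_ne x).symm).symm

open Classical in
/-- A union of strands has an even number of end points. -/
theorem sum_closed (a : Diagram m n) (C : Set (Fin m ⊕ Fin n))
    (hC : ∀ x, x ∈ C → a.partner x ∈ C) :
    ∑ w, (if w ∈ C then (1 : ZMod 2) else 0) = 0 := by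
  rw [← Finset.sum_filter]
  refine Finset.sum_involution (fun x _ => a.partner x) ?_ ?_ ?_ ?_
  · intro x _; decide
  · intro x _ _; exact a.partner_ne x
  · intro x hx
    simp only [Finset.mem_filter, Finset.mem_univ, true_and] at hx ⊢
    exact hC x hx
  · intro x _; exact a.partner_partner x

open Classical in
/-- The number modulo 2 of points of `C` in front of `x`. -/
noncomputable def before (C : Set (Fin m ⊕ Fin n)) (x : Fin m ⊕ Fin n) : ZMod 2 :=
  ∑ w, if w ∈ C ∧ pos w < pos x then 1 else 0

theorem before_eq_of_lt (a : Diagram m n) (C : Set (Fin m ⊕ Fin n))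
    (hC : ∀ x, x ∈ C → a.partner x ∈ C) {x y : Fin m ⊕ Fin n} (hx : x ∉ C) (hy : y ∉ C)
    (hxy : a.rel x y) (hlt : pos x < pos y) : before C x = before C y := by
  classical
  have key := a.sum_closed {w | w ∈ C ∧ pos x < pos w ∧ pos w < pos y} (by
    rintro w ⟨hw, h1, h2⟩
    have hr := a.rel_partner w
    have hp := hC w hw
    have hnx : pos (a.partner w) ≠ pos x := fun h => hx (pos_injective h ▸ hp)
    have hny : pos (a.partner w) ≠ pos y := fun h => hy (pos_injective h ▸ hp)
    refine ⟨hp, ?_, ?_⟩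
    · by_contra hlt'
      exact a.noncrossing (a.partner w) x w y (by omega) h1 h2 (a.rel.symm hr) hxy
    · by_contra hlt'
      exact a.noncrossing x w y (a.partner w) h1 h2 (by omega) hxy hr)
  have key' : ∑ w, (if w ∈ C ∧ pos x < pos w ∧ pos w < pos y then (1 : ZMod 2) else 0) = 0 := by
    refine Eq.trans (Finset.sum_congr rfl fun w _ => ?_) key
    by_cases h : w ∈ C ∧ pos x < pos w ∧ pos w < pos y
    · exact (if_pos h).trans (Eq.symm (if_pos h))
    · exact (if_neg h).trans (Eq.symm (if_neg h))
  suffices h : before C x + ∑ w, (if w ∈ C ∧ pos x < pos w ∧ pos w < pos y then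
      (1 : ZMod 2) else 0) = before C y by rwa [key', add_zero] at h
  rw [before, before, ← Finset.sum_add_distrib]
  refine Finset.sum_congr rfl fun w _ => ?_
  by_cases hw : w ∈ C
  · have hnx : pos w ≠ pos x := fun h => hx (pos_injective h ▸ hw)
    by_cases h1 : pos w < pos x
    · simp [hw, h1, h1.trans hlt, h1.le]
    · have h1' : pos x < pos w := by omega
      simp [hw, h1, h1']
  · simp [hw]

theorem before_eq (a : Diagram m n) (C : Set (Fin m ⊕ Fin n))
    (hC : ∀ x, x ∈ C → a.partner x ∈ C) {x y : Fin m ⊕ Fin n} (hx : x ∉ C) (hy : y ∉ C)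
    (hxy : a.rel x y) : before C x = before C y := by
  rcases lt_trichotomy (pos x) (pos y) with h | h | h
  · exact a.before_eq_of_lt C hC hx hy hxy h
  · rw [pos_injective h]
  · exact (a.before_eq_of_lt C hC hy hx (a.rel.symm hxy) h).symm

/-! ### Composition of diagrams -/

/-- The points of the upper of two stacked rectangles, among the points of both. -/
def upper : Fin l ⊕ Fin m → Fin l ⊕ Fin m ⊕ Fin n := Sum.map id Sum.inl

/-- The points of the lower of two stacked rectangles, among the points of both. -/
def lower : Fin m ⊕ Fin n → Fin l ⊕ Fin m ⊕ Fin n := Sum.inr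

/-- The points on the top and bottom edges of the stack, among the points of both rectangles. -/
def outer : Fin l ⊕ Fin n → Fin l ⊕ Fin m ⊕ Fin n := Sum.map id Sum.inr

/-- Two points of the stack of `a` (upper) and `b` (lower) are joined by a single strand. -/
inductive Strand (a : Diagram l m) (b : Diagram m n) :
    Fin l ⊕ Fin m ⊕ Fin n → Fin l ⊕ Fin m ⊕ Fin n → Prop
  | up {x y : Fin l ⊕ Fin m} : a.rel x y → Strand a b (upper x) (upper y)
  | low {x y : Fin m ⊕ Fin n} : b.rel x y → Strand a b (lower x) (lower y)

/-- Two points of the stack of `a` (upper) and `b` (lower) lie on the same curve. -/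
def glue (a : Diagram l m) (b : Diagram m n) : Setoid (Fin l ⊕ Fin m ⊕ Fin n) :=
  Relation.EqvGen.setoid (Strand a b)

/-- The number of closed loops in the stack of `a` (upper) and `b` (lower): the number of its
curves with no point on the top and bottom edges. -/
noncomputable def loops (a : Diagram l m) (b : Diagram m n) : ℕ :=
  Nat.card {c : Quotient (glue a b) // ∀ x : Fin l ⊕ Fin n, Quotient.mk (glue a b) (outer x) ≠ c}

theorem glue_upper (a : Diagram l m) (b : Diagram m n) {x y : Fin l ⊕ Fin m} (h : a.rel x y) :
    glue a b (upper x) (upper y) := Relation.EqvGen.rel _ _ (Strand.up h)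

theorem glue_lower (a : Diagram l m) (b : Diagram m n) {x y : Fin m ⊕ Fin n} (h : b.rel x y) :
    glue a b (lower x) (lower y) := Relation.EqvGen.rel _ _ (Strand.low h)

theorem outer_injective : Function.Injective (outer (l := l) (m := m) (n := n)) :=
  Sum.map_injective.2 ⟨Function.injective_id, Sum.inr_injective⟩

open Classical in
theorem card_le_two_of_degree {V : Type*} [Fintype V] (G : SimpleGraph V) (hG : G.Connected)
    (O : Finset V) (h1 : ∀ v ∈ O, G.degree v ≤ 1) (h2 : ∀ v, G.degree v ≤ 2) : O.card ≤ 2 := by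
  have hE := hG.card_vert_le_card_edgeSet_add_one
  have hs := G.sum_degrees_eq_twice_card_edges
  have hle : ∑ v, (G.degree v + if v ∈ O then 1 else 0) ≤ ∑ _v : V, 2 := by
    refine Finset.sum_le_sum fun v _ => ?_
    split_ifs with hv
    · have := h1 v hv; omega
    · have := h2 v; omega
  rw [Finset.sum_add_distrib, hs] at hle
  simp only [Finset.sum_ite_mem, Finset.univ_inter, Finset.sum_const, smul_eq_mul, mul_one,
    Finset.card_univ] at hle
  rw [Nat.card_eq_fintype_card, Nat.card_eq_fintype_card, ← SimpleGraph.edgeFinset_card] at hE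
  omega

/-- The other end of the strand of `a` at a point of the stack. -/
noncomputable def upPartner (a : Diagram l m) : Fin l ⊕ Fin m ⊕ Fin n → Fin l ⊕ Fin m ⊕ Fin n
  | Sum.inl i => upper (a.partner (Sum.inl i))
  | Sum.inr (Sum.inl j) => upper (a.partner (Sum.inr j))
  | Sum.inr (Sum.inr k) => Sum.inr (Sum.inr k)

/-- The other end of the strand of `b` at a point of the stack. -/
noncomputable def lowPartner (b : Diagram m n) : Fin l ⊕ Fin m ⊕ Fin n → Fin l ⊕ Fin m ⊕ Fin n
  | Sum.inl i => Sum.inl i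
  | Sum.inr x => lower (b.partner x)

theorem eq_of_strand (a : Diagram l m) (b : Diagram m n) {x y} (h : Strand a b x y)
    (hne : y ≠ x) : y = upPartner a x ∨ y = lowPartner b x := by
  cases h with
  | @up u v h =>
    have hv : v ≠ u := fun e => hne (e ▸ rfl)
    left
    rw [a.eq_partner h hv]
    rcases u with i | j <;> rfl
  | @low u v h =>
    have hv : v ≠ u := fun e => hne (e ▸ rfl)
    right
    rw [b.eq_partner h hv]
    rfl

theorem strand_symm (a : Diagram l m) (b : Diagram m n) {x y} (h : Strand a b x y) :
    Strand a b y x := by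
  cases h with
  | up h => exact .up (a.rel.symm h)
  | low h => exact .low (b.rel.symm h)

theorem not_three (a : Diagram l m) (b : Diagram m n) {x y z : Fin l ⊕ Fin n}
    (hxy : x ≠ y) (hxz : x ≠ z) (hyz : y ≠ z) (h1 : glue a b (outer x) (outer y))
    (h2 : glue a b (outer x) (outer z)) : False := by
  classical
  let G : SimpleGraph (Fin l ⊕ Fin m ⊕ Fin n) := SimpleGraph.fromRel (Strand a b)
  have hreach : ∀ u v, glue a b u v → G.Reachable u v := by
    intro u v h
    induction h with
    | rel u v h =>
      by_cases e : u = v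
      · rw [e]
      · exact SimpleGraph.Adj.reachable ⟨e, Or.inl h⟩
    | refl u => exact SimpleGraph.Reachable.refl u
    | symm u v _ ih => exact ih.symm
    | trans u v w _ _ ih1 ih2 => exact ih1.trans ih2
  let C := G.connectedComponentMk (outer x)
  have hx : outer x ∈ C.supp := rfl
  have hy : outer y ∈ C.supp := SimpleGraph.ConnectedComponent.sound (hreach _ _ h1).symm
  have hz : outer z ∈ C.supp := SimpleGraph.ConnectedComponent.sound (hreach _ _ h2).symm
  have hsub : ∀ v : C.supp, (C.toSimpleGraph.neighborFinset v).image Subtype.val ⊆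
      ({upPartner a v.1, lowPartner b v.1} : Finset _).erase v.1 := by
    intro v w hw
    obtain ⟨w', hw', rfl⟩ := Finset.mem_image.1 hw
    have hadj : G.Adj v.1 w'.1 :=
      (C.toSimpleGraph_adj v.2 w'.2).1 ((C.toSimpleGraph.mem_neighborFinset v w').1 hw')
    have hst : Strand a b v.1 w'.1 := hadj.2.elim id (strand_symm a b)
    refine Finset.mem_erase.2 ⟨hadj.1.symm, ?_⟩
    simpa using eq_of_strand a b hst hadj.1.symm
  have hdeg : ∀ v : C.supp, C.toSimpleGraph.degree v ≤
      (({upPartner a v.1, lowPartner b v.1} : Finset _).erase v.1).card := by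
    intro v
    rw [← SimpleGraph.card_neighborFinset_eq_degree,
      ← Finset.card_image_of_injective _ Subtype.val_injective]
    exact Finset.card_le_card (hsub v)
  have hout : ∀ (u : Fin l ⊕ Fin n) (hu : outer u ∈ C.supp),
      C.toSimpleGraph.degree ⟨outer u, hu⟩ ≤ 1 := by
    intro u hu
    refine (hdeg _).trans ?_
    have hmem : outer u ∈
        ({upPartner a (outer u), lowPartner b (outer u)} : Finset (Fin l ⊕ Fin m ⊕ Fin n)) := by
      rcases u with i | k
      · simp [outer, lowPartner]
      · simp [outer, upPartner]
    rw [Finset.card_erase_of_mem hmem]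
    have := Finset.card_le_two (a := upPartner (n := n) a (outer u))
      (b := lowPartner b (outer u))
    omega
  have hcard := card_le_two_of_degree C.toSimpleGraph C.connected_toSimpleGraph
    {⟨outer x, hx⟩, ⟨outer y, hy⟩, ⟨outer z, hz⟩} (by
      intro v hv
      simp only [Finset.mem_insert, Finset.mem_singleton] at hv
      rcases hv with rfl | rfl | rfl
      · convert hout x hx
      · convert hout y hy
      · convert hout z hz) (by
      intro v
      have h3 := (hdeg v).trans
        ((Finset.card_le_card (Finset.erase_subset _ _)).trans Finset.card_le_two)
      convert h3)
  rw [Finset.card_eq_three.2 ⟨_, _, _, ?_, ?_, ?_, rfl⟩] at hcard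
  · omega
  · simpa using fun h => hxy (outer_injective h)
  · simpa using fun h => hxz (outer_injective h)
  · simpa using fun h => hyz (outer_injective h)

theorem mem_class_iff (a : Diagram l m) (b : Diagram m n) (c : Fin l ⊕ Fin m ⊕ Fin n) {x y}
    (h : glue a b x y) : glue a b c x ↔ glue a b c y :=
  ⟨fun h' => (glue a b).trans h' h, fun h' => (glue a b).trans h' ((glue a b).symm h)⟩

theorem sum_outer (a : Diagram l m) (b : Diagram m n) (c : Fin l ⊕ Fin m ⊕ Fin n) :
    (∑ i : Fin l, open Classical in if glue a b c (Sum.inl i) then (1 : ZMod 2) else 0) =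
      (∑ j : Fin m, open Classical in if glue a b c (Sum.inr (Sum.inl j)) then (1 : ZMod 2) else 0)
    ∧ (∑ j : Fin m, open Classical in
        if glue a b c (Sum.inr (Sum.inl j)) then (1 : ZMod 2) else 0) =
      (∑ k : Fin n, open Classical in
        if glue a b c (Sum.inr (Sum.inr k)) then (1 : ZMod 2) else 0) := by
  classical
  have ha := a.sum_closed {w | glue a b c (upper w)} fun x hx =>
    (mem_class_iff a b c (glue_upper a b (a.rel_partner x))).1 hx
  have hb := b.sum_closed {w | glue a b c (lower w)} fun x hx =>
    (mem_class_iff a b c (glue_lower a b (b.rel_partner x))).1 hx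
  rw [Fintype.sum_sum_type] at ha hb
  simp only [Set.mem_ofPred_eq, upper, lower, Sum.map_inl, Sum.map_inr, id] at ha hb
  exact ⟨CharTwo.add_eq_zero.1 ha, CharTwo.add_eq_zero.1 hb⟩

theorem comp_pairing (a : Diagram l m) (b : Diagram m n) (x : Fin l ⊕ Fin n) :
    ∃! y, y ≠ x ∧ glue a b (outer x) (outer y) := by
  classical
  have hex : ∃ y, y ≠ x ∧ glue a b (outer x) (outer y) := by
    by_contra hno
    push Not at hno
    have hs : ∑ y : Fin l ⊕ Fin n, (if glue a b (outer x) (outer y) then (1 : ZMod 2) else 0)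
        = 0 := by
      obtain ⟨h1, h2⟩ := sum_outer a b (outer x)
      rw [Fintype.sum_sum_type]
      refine CharTwo.add_eq_zero.2 ?_
      exact (Finset.sum_congr rfl fun i _ => if_congr Iff.rfl rfl rfl).trans
        ((h1.trans h2).trans (Finset.sum_congr rfl fun k _ => if_congr Iff.rfl rfl rfl))
    rw [Finset.sum_eq_single x] at hs
    · rw [if_pos ((glue a b).refl _)] at hs
      exact one_ne_zero hs
    · intro y _ hy
      exact if_neg (hno y hy)
    · simp
  obtain ⟨y, hy, hxy⟩ := hex
  refine ⟨y, ⟨hy, hxy⟩, ?_⟩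
  rintro z ⟨hz, hxz⟩
  by_contra hne
  exact not_three a b hy.symm hz.symm (Ne.symm hne) hxy hxz

/-- The number modulo 2 of points of the class of `c` in front of a point of the stack. -/
noncomputable def stackBefore (a : Diagram l m) (b : Diagram m n) (c : Fin l ⊕ Fin m ⊕ Fin n) :
    Fin l ⊕ Fin m ⊕ Fin n → ZMod 2
  | Sum.inl i => before {w | glue a b c (upper w)} (Sum.inl i)
  | Sum.inr (Sum.inl j) => before {w | glue a b c (upper w)} (Sum.inr j)
  | Sum.inr (Sum.inr k) => before {w | glue a b c (lower w)} (Sum.inr k)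

theorem stackBefore_upper (a : Diagram l m) (b : Diagram m n) (c : Fin l ⊕ Fin m ⊕ Fin n) (x) :
    stackBefore a b c (upper x) = before {w | glue a b c (upper w)} x := by
  rcases x with i | j <;> rfl

theorem stackBefore_lower (a : Diagram l m) (b : Diagram m n) (c : Fin l ⊕ Fin m ⊕ Fin n) (x)
    (hx : ¬ glue a b c (lower x)) :
    stackBefore a b c (lower x) = before {w | glue a b c (lower w)} x := by
  classical
  rcases x with j | k
  · obtain ⟨h1, -⟩ := sum_outer a b c
    simp only [lower] at hx
    simp only [stackBefore, lower, before, Fintype.sum_sum_type, Set.mem_ofPred_eq, upper,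
      Sum.map_inl, Sum.map_inr, id, pos]
    have e1 : ∀ i : Fin l, (i : ℕ) < l + (m - 1 - (j : ℕ)) := fun i => by have := i.2; omega
    have e2 : ∀ k : Fin n, ¬ (m + (n - 1 - (k : ℕ)) < (j : ℕ)) := fun k => by
      have := j.2; omega
    simp only [e1, e2, and_true, and_false, if_false, Finset.sum_const_zero, add_zero]
    have h1' : (∑ i : Fin l, if glue a b c (Sum.inl i) then (1 : ZMod 2) else 0) =
        ∑ j : Fin m, if glue a b c (Sum.inr (Sum.inl j)) then (1 : ZMod 2) else 0 := by
      convert h1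
    rw [h1', ← sub_eq_zero, CharTwo.sub_eq_add, ← Finset.sum_add_distrib,
      ← Finset.sum_add_distrib]
    refine Finset.sum_eq_zero fun j' _ => ?_
    by_cases hj : glue a b c (Sum.inr (Sum.inl j'))
    · have hne : (j' : ℕ) ≠ j := fun h => hx (Fin.ext h ▸ hj)
      have := j.2
      have := j'.2
      rcases lt_or_gt_of_ne hne with h | h
      · have h' : ¬ (l + (m - 1 - (j' : ℕ)) < l + (m - 1 - (j : ℕ))) := by omega
        simp only [hj, h, h', and_true, and_false, if_true, if_false]; decide
      · have h' : (l + (m - 1 - (j' : ℕ)) < l + (m - 1 - (j : ℕ))) := by omega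
        have h'' : ¬ ((j' : ℕ) < j) := by omega
        simp only [hj, h', h'', and_true, and_false, if_true, if_false]; decide
    · simp [hj]
  · rfl

theorem stackBefore_eq (a : Diagram l m) (b : Diagram m n) (c : Fin l ⊕ Fin m ⊕ Fin n) {x y}
    (h : glue a b x y) (hx : ¬ glue a b c x) : stackBefore a b c x = stackBefore a b c y := by
  have h' : Relation.EqvGen (Strand a b) x y := h
  clear h
  induction h' with
  | rel x y h =>
    have hy : ¬ glue a b c y :=
      fun hy => hx ((mem_class_iff a b c (Relation.EqvGen.rel _ _ h)).2 hy)
    cases h with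
    | up h =>
      rw [stackBefore_upper, stackBefore_upper]
      exact a.before_eq _ (fun w hw =>
        (mem_class_iff a b c (glue_upper a b (a.rel_partner w))).1 hw) hx hy h
    | low h =>
      rw [stackBefore_lower _ _ _ _ hx, stackBefore_lower _ _ _ _ hy]
      exact b.before_eq _ (fun w hw =>
        (mem_class_iff a b c (glue_lower a b (b.rel_partner w))).1 hw) hx hy h
  | refl x => rfl
  | symm x y h ih =>
    exact (ih fun h' => hx ((mem_class_iff a b c h).1 h')).symm
  | trans x y z h1 _ ih1 ih2 =>
    exact (ih1 hx).trans (ih2 fun h' => hx ((mem_class_iff a b c h1).2 h'))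

theorem stackBefore_outer (a : Diagram l m) (b : Diagram m n) (c : Fin l ⊕ Fin m ⊕ Fin n) (x) :
    stackBefore a b c (outer x) = before {w | glue a b c (outer w)} x := by
  classical
  rcases x with i | k
  · simp only [stackBefore, outer, before, Fintype.sum_sum_type, Set.mem_ofPred_eq, upper,
      Sum.map_inl, Sum.map_inr, id, pos]
    have e1 : ∀ j : Fin m, ¬ (l + (m - 1 - (j : ℕ)) < (i : ℕ)) := fun j => by have := i.2; omega
    have e2 : ∀ k : Fin n, ¬ (l + (n - 1 - (k : ℕ)) < (i : ℕ)) := fun k => by have := i.2; omega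
    simp only [e1, e2, and_false, if_false, Finset.sum_const_zero, add_zero]
    congr!
  · obtain ⟨h1, -⟩ := sum_outer a b c
    simp only [stackBefore, outer, before, Fintype.sum_sum_type, Set.mem_ofPred_eq, lower,
      Sum.map_inl, Sum.map_inr, id, pos]
    have e1 : ∀ i : Fin l, (i : ℕ) < l + (n - 1 - (k : ℕ)) := fun i => by have := i.2; omega
    have e2 : ∀ j : Fin m, (j : ℕ) < m + (n - 1 - (k : ℕ)) := fun j => by have := j.2; omega
    simp only [e1, e2, and_true, Nat.add_lt_add_iff_left]
    congr 1
    convert h1.symm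

theorem comp_noncrossing (a : Diagram l m) (b : Diagram m n) (w x y z : Fin l ⊕ Fin n)
    (hwx : pos w < pos x) (hxy : pos x < pos y) (hyz : pos y < pos z)
    (hwy : glue a b (outer w) (outer y)) (hxz : glue a b (outer x) (outer z)) : False := by
  classical
  have nwx : w ≠ x := fun h => by simp [h] at hwx
  have nxy : x ≠ y := fun h => by simp [h] at hxy
  have nwy : w ≠ y := fun h => by subst h; omega
  by_cases hx : glue a b (outer w) (outer x)
  · exact not_three a b nwx nwy nxy hx hwy
  · have h := stackBefore_eq a b (outer w) hxz hx
    rw [stackBefore_outer, stackBefore_outer] at h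
    have hmem : ∀ v, glue a b (outer w) (outer v) ↔ v = w ∨ v = y := by
      intro v
      constructor
      · intro hv
        by_contra hno
        push Not at hno
        exact not_three a b nwy hno.1.symm hno.2.symm hwy hv
      · rintro (rfl | rfl)
        · exact (glue a b).refl _
        · exact hwy
    have h1 : before {v | glue a b (outer w) (outer v)} x = 1 := by
      rw [before, Finset.sum_eq_single w]
      · simp [hmem, hwx]
      · intro v _ hv
        refine if_neg ?_
        rintro ⟨hv1, hv2⟩
        rcases (hmem v).1 hv1 with rfl | rfl
        · exact hv rfl
        · omega
      · simp
    have h2 : before {v | glue a b (outer w) (outer v)} z = 0 := by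
      rw [before, Finset.sum_eq_add w y nwy]
      · have e1 : pos w < pos z := by omega
        simp only [Set.mem_ofPred_eq, hmem, e1, hyz, true_or, or_true, and_self, if_true]
        decide
      · rintro v _ ⟨hv, hv'⟩
        refine if_neg ?_
        rintro ⟨hv1, -⟩
        rcases (hmem v).1 hv1 with rfl | rfl
        · exact hv rfl
        · exact hv' rfl
      · simp
      · simp
    rw [h1, h2] at h
    exact one_ne_zero h

/-- The diagram obtained by stacking `a` on top of `b` and removing the closed loops. -/
def stack (a : Diagram l m) (b : Diagram m n) : Diagram l n where
  rel := (glue a b).comap outer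
  pairing := comp_pairing a b
  noncrossing := comp_noncrossing a b

/-! ### Juxtaposition, identity, cup and cap, closure -/

/-- The points of two rectangles placed side by side. -/
def split {m n m' n' : ℕ} :
    Fin (m + m') ⊕ Fin (n + n') ≃ (Fin m ⊕ Fin n) ⊕ (Fin m' ⊕ Fin n') :=
  (Equiv.sumCongr finSumFinEquiv.symm finSumFinEquiv.symm).trans (Equiv.sumSumSumComm _ _ _ _)

/-- The pairing by the strands of `a` and of `b`. -/
def sumRel {m n m' n' : ℕ} (a : Diagram m n) (b : Diagram m' n') :
    Setoid ((Fin m ⊕ Fin n) ⊕ (Fin m' ⊕ Fin n')) where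
  r := Sum.LiftRel a.rel b.rel
  iseqv :=
    { refl := by
        rintro (x | x)
        · exact .inl (a.rel.refl x)
        · exact .inr (b.rel.refl x)
      symm := by
        rintro _ _ (h | h)
        · exact .inl (a.rel.symm h)
        · exact .inr (b.rel.symm h)
      trans := by
        rintro _ _ _ (h | h) (h' | h')
        · exact .inl (a.rel.trans h h')
        · exact .inr (b.rel.trans h h') }

/-- Place of a point of the left rectangle on the boundary of the juxtaposition. -/
theorem pos_split_inl {m n m' n' : ℕ} (x : Fin m ⊕ Fin n) :
    pos ((split (m' := m') (n' := n')).symm (Sum.inl x)) =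
      if pos x < m then pos x else pos x + (m' + n') := by
  rcases x with i | j
  · simp [split, pos]
  · have := j.2
    simp [split, pos]
    omega

/-- Place of a point of the right rectangle on the boundary of the juxtaposition. -/
theorem pos_split_inr {m n m' n' : ℕ} (x : Fin m' ⊕ Fin n') :
    pos ((split (m := m) (n := n)).symm (Sum.inr x)) = m + pos x := by
  rcases x with i | j
  · simp [split, pos]
  · have := j.2
    simp [split, pos]
    omega

theorem pos_lt {m n : ℕ} (x : Fin m ⊕ Fin n) : pos x < m + n := by
  rcases x with i | j
  · have := i.2; simp only [pos]; omega
  · have := j.2; simp only [pos]; omega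

/-- Horizontal juxtaposition, `a` on the left and `b` on the right. -/
def tensor {m n m' n' : ℕ} (a : Diagram m n) (b : Diagram m' n') :
    Diagram (m + m') (n + n') where
  rel := (sumRel a b).comap split
  pairing := by
    intro x
    obtain ⟨x, rfl⟩ := split.symm.surjective x
    rcases x with x | x
    · refine ⟨split.symm (.inl (a.partner x)), ⟨?_, ?_⟩, ?_⟩
      · simpa using a.partner_ne x
      · rw [Setoid.comap_rel, Equiv.apply_symm_apply, Equiv.apply_symm_apply]
        exact Sum.LiftRel.inl (a.rel_partner x)
      · intro y hy
        obtain ⟨y, rfl⟩ := split.symm.surjective y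
        obtain ⟨hne, hy⟩ := hy
        rw [Setoid.comap_rel, Equiv.apply_symm_apply, Equiv.apply_symm_apply] at hy
        rcases hy with @⟨_, y, hy⟩
        rw [a.eq_partner hy (by simpa using hne)]
    · refine ⟨split.symm (.inr (b.partner x)), ⟨?_, ?_⟩, ?_⟩
      · simpa using b.partner_ne x
      · rw [Setoid.comap_rel, Equiv.apply_symm_apply, Equiv.apply_symm_apply]
        exact Sum.LiftRel.inr (b.rel_partner x)
      · intro y hy
        obtain ⟨y, rfl⟩ := split.symm.surjective y
        obtain ⟨hne, hy⟩ := hy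
        rw [Setoid.comap_rel, Equiv.apply_symm_apply, Equiv.apply_symm_apply] at hy
        rcases hy with _ | @⟨_, y, hy⟩
        rw [b.eq_partner hy (by simpa using hne)]
  noncrossing := by
    intro w x y z
    obtain ⟨w, rfl⟩ := split.symm.surjective w
    obtain ⟨x, rfl⟩ := split.symm.surjective x
    obtain ⟨y, rfl⟩ := split.symm.surjective y
    obtain ⟨z, rfl⟩ := split.symm.surjective z
    intro hwx hxy hyz hwy hxz
    rw [Setoid.comap_rel, Equiv.apply_symm_apply, Equiv.apply_symm_apply] at hwy hxz
    rcases hwy with @⟨w, y, hwy⟩ | @⟨w, y, hwy⟩ <;> rcases hxz with @⟨x, z, hxz⟩ | @⟨x, z, hxz⟩ <;>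
      simp only [pos_split_inl, pos_split_inr] at hwx hxy hyz
    · refine a.noncrossing w x y z ?_ ?_ ?_ hwy hxz <;> split_ifs at hwx hxy hyz <;> omega
    · have := pos_lt x
      have := pos_lt z
      split_ifs at hwx hxy hyz <;> omega
    · have := pos_lt w
      have := pos_lt y
      split_ifs at hwx hxy hyz <;> omega
    · exact b.noncrossing w x y z (by omega) (by omega) (by omega) hwy hxz

/-- The diagram with `n` vertical strands. -/
def identity (n : ℕ) : Diagram n n where
  rel := Setoid.ker (Sum.elim id id)
  pairing := by
    rintro (i | i)
    · refine ⟨.inr i, ⟨by simp, by simp [Setoid.ker_def]⟩, ?_⟩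
      rintro (j | j) ⟨hne, h⟩ <;> simp_all [Setoid.ker_def]
    · refine ⟨.inl i, ⟨by simp, by simp [Setoid.ker_def]⟩, ?_⟩
      rintro (j | j) ⟨hne, h⟩ <;> simp_all [Setoid.ker_def]
  noncrossing := by
    rintro (w | w) (x | x) (y | y) (z | z) hwx hxy hyz hwy hxz <;>
      simp only [Setoid.ker_def, Sum.elim_inl, Sum.elim_inr, id, pos] at * <;> subst hwy hxz <;>
      omega

/-- The single strand joining two bottom points. -/
def cap : Diagram 0 2 where
  rel := ⊤
  pairing := by
    rintro (i | i)
    · exact i.elim0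
    · refine ⟨.inr (Fin.rev i), ⟨by fin_cases i <;> simp, trivial⟩, ?_⟩
      rintro (j | j) ⟨hne, -⟩
      · exact j.elim0
      · fin_cases i <;> fin_cases j <;> simp_all
  noncrossing := by
    intro w x y z h1 h2 h3
    have := pos_lt z
    omega

/-- The single strand joining two top points. -/
def cup : Diagram 2 0 where
  rel := ⊤
  pairing := by
    rintro (i | i)
    · refine ⟨.inl (Fin.rev i), ⟨by fin_cases i <;> simp, trivial⟩, ?_⟩
      rintro (j | j) ⟨hne, -⟩
      · fin_cases i <;> fin_cases j <;> simp_all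
      · exact j.elim0
    · exact i.elim0
  noncrossing := by
    intro w x y z h1 h2 h3
    have := pos_lt z
    omega

/-- The number of closed loops obtained by joining each top point of an `(n, n)`-diagram to the
bottom point below it by an arc outside of the rectangle. -/
noncomputable def closureLoops (a : Diagram n n) : ℕ :=
  Nat.card (Quotient (a.rel ⊔ (identity n).rel))

end Diagram

/-! ### The category -/

section Category

variable {K : Type*} [Field K]

/-- Morphisms from `m` to `n`: the vector space with basis the `(m, n)`-diagrams. -/
abbrev Hom (K : Type*) [Field K] (m n : ℕ) : Type _ := Diagram m n →₀ K

/-- The morphism given by a diagram. -/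
noncomputable def Hom.of (K : Type*) [Field K] {m n : ℕ} (a : Diagram m n) : Hom K m n :=
  Finsupp.single a 1

/-- The composition `b ∘ a`, where each closed loop is replaced by the factor `d`. -/
noncomputable def comp (d : K) {l m n : ℕ} : Hom K m n →ₗ[K] Hom K l m →ₗ[K] Hom K l n :=
  Finsupp.linearCombination K fun b : Diagram m n =>
    Finsupp.linearCombination K fun a : Diagram l m =>
      d ^ Diagram.loops a b • Hom.of K (Diagram.stack a b)

/-- The tensor product `a ⊗ b` of morphisms. -/
noncomputable def tensor {m n m' n' : ℕ} :
    Hom K m n →ₗ[K] Hom K m' n' →ₗ[K] Hom K (m + m') (n + n') :=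
  Finsupp.linearCombination K fun a : Diagram m n =>
    Finsupp.linearCombination K fun b : Diagram m' n' => Hom.of K (Diagram.tensor a b)

/-- The identity morphism of `n`. -/
noncomputable def one (K : Type*) [Field K] (n : ℕ) : Hom K n n := Hom.of K (Diagram.identity n)

/-- The Markov trace. -/
noncomputable def trace (d : K) {n : ℕ} : Hom K n n →ₗ[K] K :=
  Finsupp.linearCombination K fun a : Diagram n n => d ^ a.closureLoops

/-- The negligible morphisms from `m` to `n`. -/
noncomputable def negligible (d : K) (m n : ℕ) : Submodule K (Hom K m n) where
  carrier := {a | ∀ b : Hom K n m, trace d (comp d a b) = 0}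
  add_mem' := by
    intro a a' ha ha' b
    simp [ha b, ha' b]
  zero_mem' := by simp
  smul_mem' := by
    intro c a ha b
    simp [ha b]

/-- An ideal of the category with loop value `d`: a family of subspaces of the morphism spaces
which is closed under composition and tensor product with arbitrary morphisms. -/
structure TensorIdeal (d : K) where
  hom : ∀ m n : ℕ, Submodule K (Hom K m n)
  comp_left : ∀ {l m n : ℕ} (b : Hom K m n) (a : Hom K l m), a ∈ hom l m → comp d b a ∈ hom l n
  comp_right : ∀ {l m n : ℕ} (b : Hom K m n) (a : Hom K l m), b ∈ hom m n → comp d b a ∈ hom l n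
  tensor_left : ∀ {m n m' n' : ℕ} (a : Hom K m n) (b : Hom K m' n'),
    b ∈ hom m' n' → tensor a b ∈ hom (m + m') (n + n')
  tensor_right : ∀ {m n m' n' : ℕ} (a : Hom K m n) (b : Hom K m' n'),
    a ∈ hom m n → tensor a b ∈ hom (m + m') (n + n')

/-- The ideal generated by a morphism `p`: the intersection of all ideals that contain it. -/
noncomputable def TensorIdeal.generatedBy (d : K) {r s : ℕ} (p : Hom K r s) : TensorIdeal d where
  hom m n := ⨅ (J : TensorIdeal d) (_ : p ∈ J.hom r s), J.hom m n
  comp_left b a h := by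
    simp only [Submodule.mem_iInf] at h ⊢
    exact fun J hJ => J.comp_left b a (h J hJ)
  comp_right b a h := by
    simp only [Submodule.mem_iInf] at h ⊢
    exact fun J hJ => J.comp_right b a (h J hJ)
  tensor_left a b h := by
    simp only [Submodule.mem_iInf] at h ⊢
    exact fun J hJ => J.tensor_left a b (h J hJ)
  tensor_right a b h := by
    simp only [Submodule.mem_iInf] at h ⊢
    exact fun J hJ => J.tensor_right a b (h J hJ)

/-- The loop value `t + t⁻¹`. -/
def loopValue (t : K) : K := t + t⁻¹

/-- The quantum integer `[k] = (t ^ k - t ^ (-k)) / (t - t⁻¹)`. -/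
def quantumInt (t : K) (k : ℕ) : K := (t ^ k - t⁻¹ ^ k) / (t - t⁻¹)

end Category

/-! ### Jones–Wenzl idempotents and specialization -/

/-- The generic Jones–Wenzl idempotent `p_[n]` in `End(n)` over `ℂ(t)`, by Wenzl's recursion
`p_[n+1] = p_[n] ⊗ 1 - ([n] / [n+1]) (p_[n] ⊗ 1) e_n (p_[n] ⊗ 1)`, where `e_n` consists of `n - 1`
vertical strands followed by a cup and a cap. -/
noncomputable def jonesWenzl : (n : ℕ) → Hom (RatFunc ℂ) n n
  | 0 => one _ 0
  | 1 => one _ 1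
  | n + 2 =>
    let d : RatFunc ℂ := loopValue RatFunc.X
    let p : Hom (RatFunc ℂ) (n + 2) (n + 2) := tensor (jonesWenzl (n + 1)) (one _ 1)
    let e : Hom (RatFunc ℂ) (n + 2) (n + 2) :=
      tensor (one _ n) (comp d (Hom.of _ Diagram.cap) (Hom.of _ Diagram.cup))
    p - (quantumInt (RatFunc.X : RatFunc ℂ) (n + 1) / quantumInt RatFunc.X (n + 2)) • comp d p (comp d e p)

/-- A morphism over `ℂ(t)` is evaluable at `τ` if its coefficients have no pole at `τ`. -/
def Evaluable (τ : ℂ) {m n : ℕ} (f : Hom (RatFunc ℂ) m n) : Prop :=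
  ∀ a : Diagram m n, (f a).denom.eval τ ≠ 0

/-- The evaluation at `τ` of a morphism over `ℂ(t)`, coefficient by coefficient (meaningful for
evaluable morphisms). -/
noncomputable def evalAt (τ : ℂ) {m n : ℕ} (f : Hom (RatFunc ℂ) m n) : Hom ℂ m n :=
  f.mapRange (RatFunc.eval (RingHom.id ℂ) τ) (RatFunc.eval_zero _ _)

end TemperleyLieb

/-!
At `t = τ` the quantum integers `[1], …, [ℓ-1]` do not vanish while `[ℓ] = 0`, so Wenzl's recursion
makes sense over `ℂ` up to `p_[ℓ-1]`; the element `jw τ n` which it defines for `n ≤ ℓ - 1` is the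
value at `τ` of the generic idempotent (`Hom.SpecializesTo.jw`), and the usual induction shows that
it is an idempotent of trace `[n+1]` that annihilates all cups and caps (`jw_comp_jw`, `trace_jw`,
`jw_comp_of_adjacentAt`). A diagram without cups and caps is an identity
(`Diagram.cases_adjacent`), hence `p_[n] x p_[m]` is zero for `m ≠ n` and a multiple of `p_[n]` for
`m = n`.

Consequently `p_[ℓ-1]` is negligible: all traces `Tr (p_[ℓ-1] b)` are multiples of
`Tr p_[ℓ-1] = [ℓ] = 0`. The negligible morphisms form an ideal; for the tensor product this rests on
partial traces (`Diagram.exists_partialTrace_right`, `Diagram.exists_partialTrace_left`).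
This gives one inclusion.

For the other one, let `J` be an ideal that contains `p_[ℓ-1]`. Wenzl's recursion, read as a
decomposition of `p_[k] ⊗ 1` into `p_[k+1]` and a morphism that factors through `p_[k-1]`, shows
that modulo `J` each identity morphism is a sum of morphisms `f p_[k] g` with `k ≤ ℓ - 2`
(`one_mem_factorSpan`). A negligible `a` is therefore, modulo `J`, a sum of morphisms
`f p_[k] (g a f') p_[k'] g'`. Here `p_[k] (g a f') p_[k']` is zero or a negligible multiple of `p_[k]`,
whose trace `[k+1]` is not zero; so it vanishes, and `a` lies in `J` (`negligible_le`).

The laws of the category (associativity, interchange, zigzag, invariance of the trace under cyclic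
permutation, reflection) are identities between diagrams together with their numbers of loops. They
are all read off from a faithful state sum: a diagram is sent to the 0-1 matrix of the colourings
of its end points by two colours that are constant along strands (`Diagram.states`). Stacking
becomes matrix multiplication with a factor `2` for each loop (`Diagram.states_mul`), juxtaposition
becomes the Kronecker product (`Diagram.states_tensor`), and a diagram with its number of loops is
determined by its matrix (`Diagram.eq_of_states`).
-/

namespace TemperleyLieb

/-! ### Counting colourings of an equivalence relation -/

/-- The colourings `φ` that are constant on the classes of `r` and prolong `χ` along `f`: there are
two choices for each class that does not meet the range of `f`. -/
theorem card_colourings {U V : Type*} [Finite V] (r : Setoid V) (f : U → V) (χ : U → Bool)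
    (hχ : ∀ u v, r (f u) (f v) → χ u = χ v) :
    Nat.card {φ : V → Bool // (∀ v w, r v w → φ v = φ w) ∧ ∀ u, φ (f u) = χ u} =
      2 ^ Nat.card {c : Quotient r // ∀ u, Quotient.mk r (f u) ≠ c} := by
  classical
  have hfree : Nat.card ({c : Quotient r // ∀ u, Quotient.mk r (f u) ≠ c} → Bool) =
      2 ^ Nat.card {c : Quotient r // ∀ u, Quotient.mk r (f u) ≠ c} := by
    have := Fintype.ofFinite {c : Quotient r // ∀ u, Quotient.mk r (f u) ≠ c}
    simp
  rw [← hfree]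
  refine Nat.card_congr (Equiv.ofBijective
    (fun φ c => Quotient.lift φ.1 (fun v w h => φ.2.1 v w h) c.1) ⟨?_, ?_⟩)
  · rintro ⟨φ, hφ, hφf⟩ ⟨ψ, hψ, hψf⟩ h
    refine Subtype.ext (funext fun v => ?_)
    by_cases hv : ∀ u, Quotient.mk r (f u) ≠ Quotient.mk r v
    · exact congrFun h ⟨Quotient.mk r v, hv⟩
    · push Not at hv
      obtain ⟨u, hu⟩ := hv
      have huv : r (f u) v := Quotient.exact hu
      change φ v = ψ v
      rw [← hφ _ _ huv, ← hψ _ _ huv, hφf, hψf]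
  · intro g
    let φ : V → Bool := fun v =>
      if hv : ∀ u, Quotient.mk r (f u) ≠ Quotient.mk r v then g ⟨_, hv⟩
      else χ (Classical.choose (not_forall.1 hv))
    have hφ : ∀ v w, r v w → φ v = φ w := by
      intro v w h
      have hq : Quotient.mk r v = Quotient.mk r w := Quotient.sound h
      simp only [φ, hq]
    refine ⟨⟨φ, hφ, fun u => ?_⟩, ?_⟩
    · have hu : ¬ ∀ u', Quotient.mk r (f u') ≠ Quotient.mk r (f u) := fun h => h u rfl
      simp only [φ, dif_neg hu]
      exact hχ _ _ (Quotient.exact (not_not.1 (Classical.choose_spec (not_forall.1 hu))))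
    · funext ⟨c, hc⟩
      induction c using Quotient.inductionOn with
      | h v => exact dif_pos hc

namespace Diagram

variable {l m n : ℕ}

/-! ### State sums -/

/-- A colouring of the marked points by two colours is compatible with a diagram if it is constant
along each strand. -/
def Compat (a : Diagram m n) (x : Fin m → Bool) (y : Fin n → Bool) : Prop :=
  ∀ u v, a.rel u v → Sum.elim x y u = Sum.elim x y v

open Classical in
/-- The matrix of a diagram: the indicator function of the compatible colourings. Composition of
diagrams becomes multiplication of matrices, with the value `2` for each closed loop. -/
noncomputable def states (a : Diagram m n) : Matrix (Fin m → Bool) (Fin n → Bool) ℕ :=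
  fun x y => if a.Compat x y then 1 else 0

/-- Each strand of `a` is a strand of `b` if the colourings constant on the strands of `b` are
constant on those of `a`. -/
theorem rel_le_of_compat {a b : Diagram m n} (h : ∀ x y, b.Compat x y → a.Compat x y)
    {u v : Fin m ⊕ Fin n} (huv : a.rel u v) : b.rel u v := by
  classical
  -- the indicator function of the strand of `b` at `u` is compatible with `b`
  let χ : Fin m ⊕ Fin n → Bool := fun w => decide (b.rel u w)
  have hχ : Sum.elim (fun i => χ (.inl i)) (fun j => χ (.inr j)) = χ := by
    funext w; rcases w with i | j <;> rfl
  have hb : b.Compat (fun i => χ (.inl i)) (fun j => χ (.inr j)) := by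
    intro p q hpq
    rw [hχ]
    exact decide_eq_decide.2
      ⟨fun h' => b.rel.trans h' hpq, fun h' => b.rel.trans h' (b.rel.symm hpq)⟩
  have ha := h _ _ hb u v huv
  rw [hχ] at ha
  exact of_decide_eq_true (ha.symm.trans (decide_eq_true (b.rel.refl u)))

/-- A diagram and a number of loops are determined by their state sum. -/
theorem eq_of_states {a b : Diagram m n} {j k : ℕ}
    (h : 2 ^ j • states a = 2 ^ k • states b) : j = k ∧ a = b := by
  classical
  have hc : ∀ c : Diagram m n, c.Compat (fun _ => true) (fun _ => true) := by
    intro c u v _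
    rcases u with u | u <;> rcases v with v | v <;> rfl
  have hjk : j = k := by
    have := congrFun (congrFun h fun _ => true) fun _ => true
    simp only [Matrix.smul_apply, states, if_pos (hc _), smul_eq_mul, mul_one] at this
    exact Nat.pow_right_injective le_rfl this
  subst hjk
  have hab : ∀ x y, a.Compat x y ↔ b.Compat x y := by
    intro x y
    have := congrFun (congrFun h x) y
    simp only [Matrix.smul_apply, states, smul_eq_mul] at this
    have := Nat.eq_of_mul_eq_mul_left (by positivity) this
    by_cases h1 : a.Compat x y <;> by_cases h2 : b.Compat x y <;> simp [h1, h2] at this ⊢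
  refine ⟨rfl, Diagram.ext (Setoid.ext fun u v => ⟨?_, ?_⟩)⟩
  · exact rel_le_of_compat fun x y => (hab x y).2
  · exact rel_le_of_compat fun x y => (hab x y).1

theorem eq_of_states_eq {a b : Diagram m n} (h : states a = states b) : a = b :=
  (eq_of_states (j := 0) (k := 0) (by rw [h])).2

theorem sum_ite_eq_card {α : Type*} [Fintype α] (p : α → Prop) [DecidablePred p] :
    ∑ x, (if p x then 1 else 0) = Nat.card {x // p x} := by
  rw [Finset.sum_boole, Nat.card_eq_fintype_card, Fintype.card_subtype]
  rfl

/-- Compatible colourings of two stacked diagrams are the colourings of the stack that are constant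
along its curves. -/
theorem compat_and_compat_iff (a : Diagram l m) (b : Diagram m n) (x y z) :
    a.Compat x y ∧ b.Compat y z ↔
      ∀ v w, glue a b v w → Sum.elim x (Sum.elim y z) v = Sum.elim x (Sum.elim y z) w := by
  have hu : ∀ u : Fin l ⊕ Fin m,
      Sum.elim x (Sum.elim y z) (upper u) = Sum.elim x y u := by
    rintro (u | u) <;> rfl
  constructor
  · rintro ⟨h1, h2⟩ v w h
    replace h : Relation.EqvGen (Strand a b) v w := h
    induction h with
    | rel v w h =>
      cases h with
      | up h => rw [hu, hu]; exact h1 _ _ h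
      | low h => exact h2 _ _ h
    | refl v => rfl
    | symm v w _ ih => exact ih.symm
    | trans u v w _ _ ih1 ih2 => exact ih1.trans ih2
  · intro h
    refine ⟨fun u v huv => ?_, fun u v huv => h _ _ (glue_lower a b huv)⟩
    rw [← hu, ← hu]
    exact h _ _ (glue_upper a b huv)

/-- For each colouring of the outer points of a stack that is constant along its curves, the closed
loops can be coloured freely. -/
theorem states_mul (a : Diagram l m) (b : Diagram m n) :
    states a * states b = 2 ^ loops a b • states (stack a b) := by
  classical
  ext x z
  have hsum : (states a * states b) x z = Nat.card {y // a.Compat x y ∧ b.Compat y z} := by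
    rw [← sum_ite_eq_card, Matrix.mul_apply]
    refine Finset.sum_congr rfl fun y _ => ?_
    by_cases h1 : a.Compat x y <;> by_cases h2 : b.Compat y z <;> simp [states, h1, h2]
  have ho : ∀ y : Fin m → Bool, ∀ u : Fin l ⊕ Fin n,
      Sum.elim x (Sum.elim y z) (outer u) = Sum.elim x z u := by
    rintro y (u | u) <;> rfl
  rw [hsum, Matrix.smul_apply, states]
  by_cases h : (stack a b).Compat x z
  · rw [if_pos h, smul_eq_mul, mul_one, loops,
      ← card_colourings (glue a b) outer (Sum.elim x z) fun u v huv => h u v huv]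
    refine Nat.card_congr
      { toFun := fun y => ⟨Sum.elim x (Sum.elim y.1 z),
          (compat_and_compat_iff a b x y.1 z).1 y.2, ho y.1⟩
        invFun := fun φ => ⟨fun j => φ.1 (.inr (.inl j)), ?_⟩
        left_inv := fun y => rfl
        right_inv := ?_ }
    · rw [compat_and_compat_iff]
      have hφ : Sum.elim x (Sum.elim (fun j => φ.1 (.inr (.inl j))) z) = φ.1 := by
        funext w
        rcases w with i | j | k
        · exact (φ.2.2 (.inl i)).symm
        · rfl
        · exact (φ.2.2 (.inr k)).symm
      rw [hφ]
      exact φ.2.1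
    · intro φ
      refine Subtype.ext (funext fun w => ?_)
      rcases w with i | j | k
      · exact (φ.2.2 (.inl i)).symm
      · rfl
      · exact (φ.2.2 (.inr k)).symm
  · rw [if_neg h, smul_zero, Nat.card_eq_zero]
    refine Or.inl ⟨fun y => h fun u v huv => ?_⟩
    have := (compat_and_compat_iff a b x y.1 z).1 y.2 _ _ huv
    rwa [ho, ho] at this

theorem compat_identity_iff {x y : Fin n → Bool} : (identity n).Compat x y ↔ x = y := by
  constructor
  · intro h
    funext i
    exact h (.inl i) (.inr i) rfl
  · rintro rfl u v h
    have hu : ∀ w, Sum.elim x x w = x (Sum.elim id id w) := by rintro (w | w) <;> rfl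
    rw [hu, hu]
    exact congrArg x h

theorem states_identity : states (identity n) = 1 := by
  classical
  ext x y
  simp only [states, compat_identity_iff, Matrix.one_apply]

theorem trace_states (a : Diagram n n) : (states a).trace = 2 ^ a.closureLoops := by
  classical
  have hsum : (states a).trace = Nat.card {x // a.Compat x x} := by
    rw [← sum_ite_eq_card]
    rfl
  have hc := card_colourings (a.rel ⊔ (identity n).rel) Empty.elim Empty.elim (fun u => u.elim)
  have hfree : Nat.card {c : Quotient (a.rel ⊔ (identity n).rel) //
      ∀ u : Empty, Quotient.mk (a.rel ⊔ (identity n).rel) u.elim ≠ c} = a.closureLoops :=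
    Nat.card_congr (Equiv.subtypeUnivEquiv fun c u => u.elim)
  rw [hfree] at hc
  rw [hsum, ← hc]
  have hinv : ∀ φ : Fin n ⊕ Fin n → Bool,
      (∀ v w, (a.rel ⊔ (identity n).rel) v w → φ v = φ w) ↔
        a.rel ≤ Setoid.ker φ ∧ (identity n).rel ≤ Setoid.ker φ := by
    intro φ
    rw [← sup_le_iff]
    rfl
  have hid : ∀ {φ : Fin n ⊕ Fin n → Bool}, (identity n).rel ≤ Setoid.ker φ →
      Sum.elim (fun i => φ (.inl i)) (fun i => φ (.inl i)) = φ := by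
    intro φ h
    funext w
    rcases w with i | i
    · rfl
    · exact h (show (identity n).rel (.inl i) (.inr i) from rfl)
  refine Nat.card_congr
    { toFun := fun x => ⟨Sum.elim x.1 x.1, (hinv _).2 ⟨fun u v h => x.2 u v h, fun u v h =>
        compat_identity_iff.2 rfl u v h⟩, fun u => u.elim⟩
      invFun := fun φ => ⟨fun i => φ.1 (.inl i), fun u v h => ?_⟩
      left_inv := fun x => rfl
      right_inv := fun φ => Subtype.ext (hid ((hinv _).1 φ.2.1).2) }
  rw [hid ((hinv _).1 φ.2.1).2]
  exact ((hinv _).1 φ.2.1).1 h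

theorem compat_tensor_iff {m' n' : ℕ} (a : Diagram m n) (b : Diagram m' n')
    (x : Fin m → Bool) (x' : Fin m' → Bool) (y : Fin n → Bool) (y' : Fin n' → Bool) :
    (tensor a b).Compat (Fin.append x x') (Fin.append y y') ↔ a.Compat x y ∧ b.Compat x' y' := by
  have hl : ∀ u, Sum.elim (Fin.append x x') (Fin.append y y')
      (split.symm (Sum.inl u : (Fin m ⊕ Fin n) ⊕ (Fin m' ⊕ Fin n'))) = Sum.elim x y u := by
    rintro (u | u) <;> simp [split]
  have hr : ∀ u, Sum.elim (Fin.append x x') (Fin.append y y')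
      (split.symm (Sum.inr u : (Fin m ⊕ Fin n) ⊕ (Fin m' ⊕ Fin n'))) = Sum.elim x' y' u := by
    rintro (u | u) <;> simp [split]
  have hrel : ∀ u v, (tensor a b).rel (split.symm u) (split.symm v) ↔
      Sum.LiftRel a.rel b.rel u v := by
    intro u v
    change Sum.LiftRel _ _ _ _ ↔ _
    rw [Equiv.apply_symm_apply, Equiv.apply_symm_apply]
  constructor
  · intro h
    refine ⟨fun u v huv => ?_, fun u v huv => ?_⟩
    · rw [← hl, ← hl]; exact h _ _ ((hrel _ _).2 (.inl huv))
    · rw [← hr, ← hr]; exact h _ _ ((hrel _ _).2 (.inr huv))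
  · rintro ⟨h1, h2⟩ u v huv
    obtain ⟨u, rfl⟩ := split.symm.surjective u
    obtain ⟨v, rfl⟩ := split.symm.surjective v
    rcases (hrel _ _).1 huv with h | h
    · rw [hl, hl]; exact h1 _ _ h
    · rw [hr, hr]; exact h2 _ _ h

theorem states_tensor {m' n' : ℕ} (a : Diagram m n) (b : Diagram m' n')
    (x : Fin m → Bool) (x' : Fin m' → Bool) (y : Fin n → Bool) (y' : Fin n' → Bool) :
    states (tensor a b) (Fin.append x x') (Fin.append y y') = states a x y * states b x' y' := by
  by_cases h1 : a.Compat x y <;> by_cases h2 : b.Compat x' y' <;>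
    simp [states, compat_tensor_iff, h1, h2]

theorem sum_append {m n : ℕ} {M : Type*} [AddCommMonoid M] (f : (Fin (m + n) → Bool) → M) :
    ∑ z, f z = ∑ x : Fin m → Bool, ∑ y : Fin n → Bool, f (Fin.append x y) := by
  rw [← (Fin.appendEquiv m n).sum_comp, Fintype.sum_prod_type]
  rfl

theorem forall_append {m n : ℕ} {p : (Fin (m + n) → Bool) → Prop} :
    (∀ z, p z) ↔ ∀ (x : Fin m → Bool) (y : Fin n → Bool), p (Fin.append x y) := by
  refine ⟨fun h x y => h _, fun h z => ?_⟩
  obtain ⟨⟨x, y⟩, rfl⟩ := (Fin.appendEquiv m n).surjective z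
  exact h x y

/-! ### The laws of composition and juxtaposition of diagrams -/

theorem stack_assoc {k : ℕ} (a : Diagram k l) (b : Diagram l m) (c : Diagram m n) :
    loops a b + loops (stack a b) c = loops b c + loops a (stack b c) ∧
      stack (stack a b) c = stack a (stack b c) := by
  refine eq_of_states ?_
  rw [pow_add, pow_add, mul_smul, mul_smul, ← states_mul, ← states_mul, ← Matrix.smul_mul,
    ← Matrix.mul_smul, ← states_mul, ← states_mul, Matrix.mul_assoc]

theorem identity_stack (a : Diagram m n) : loops (identity m) a = 0 ∧ stack (identity m) a = a := by
  refine eq_of_states ?_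
  rw [← states_mul, states_identity, pow_zero, one_smul, Matrix.one_mul]

theorem stack_identity (a : Diagram m n) : loops a (identity n) = 0 ∧ stack a (identity n) = a := by
  refine eq_of_states ?_
  rw [← states_mul, states_identity, pow_zero, one_smul, Matrix.mul_one]

theorem tensor_stack {l' m' n' : ℕ} (a : Diagram l m) (b : Diagram m n) (a' : Diagram l' m')
    (b' : Diagram m' n') :
    loops (tensor a a') (tensor b b') = loops a b + loops a' b' ∧
      stack (tensor a a') (tensor b b') = tensor (stack a b) (stack a' b') := by
  refine eq_of_states ?_
  rw [← states_mul]
  funext x z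
  revert z
  rw [forall_append]
  revert x
  rw [forall_append]
  intro x x' z z'
  have h := congrFun (congrFun (states_mul a b) x) z
  have h' := congrFun (congrFun (states_mul a' b') x') z'
  simp only [Matrix.mul_apply, Matrix.smul_apply, smul_eq_mul] at h h' ⊢
  rw [states_tensor, pow_add, mul_mul_mul_comm, ← h, ← h', sum_append, Finset.sum_mul_sum]
  refine Finset.sum_congr rfl fun y _ => Finset.sum_congr rfl fun y' _ => ?_
  rw [states_tensor, states_tensor, mul_mul_mul_comm]

theorem tensor_identity : tensor (identity m) (identity n) = identity (m + n) := by
  classical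
  refine eq_of_states_eq ?_
  funext x z
  revert z
  rw [forall_append]
  revert x
  rw [forall_append]
  intro x x' z z'
  rw [states_tensor, states_identity, states_identity, states_identity]
  have : Fin.append x x' = Fin.append z z' ↔ x = z ∧ x' = z' := by
    rw [← Prod.mk_inj]
    exact (Fin.appendEquiv m n).injective.eq_iff (a := (x, x')) (b := (z, z'))
  simp only [Matrix.one_apply, this]
  by_cases h1 : x = z <;> by_cases h2 : x' = z' <;> simp [h1, h2]

theorem closureLoops_comm (a : Diagram m n) (b : Diagram n m) :
    loops a b + closureLoops (stack a b) = loops b a + closureLoops (stack b a) := by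
  refine Nat.pow_right_injective le_rfl ?_
  change 2 ^ _ = 2 ^ _
  rw [pow_add, pow_add, ← trace_states, ← trace_states, ← smul_eq_mul, ← smul_eq_mul,
    ← Matrix.trace_smul, ← Matrix.trace_smul, ← states_mul, ← states_mul, Matrix.trace_mul_comm]

/-- A diagram with its numbers of points rewritten along equalities. -/
def cast {m' n' : ℕ} (hm : m = m') (hn : n = n') (a : Diagram m n) : Diagram m' n' :=
  hm ▸ hn ▸ a

theorem states_cast {m' n' : ℕ} (hm : m = m') (hn : n = n') (a : Diagram m n) (x y) :
    states (cast hm hn a) x y = states a (x ∘ Fin.cast hm) (y ∘ Fin.cast hn) := by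
  subst hm hn
  rfl

theorem tensor_assoc {m' n' m'' n'' : ℕ} (a : Diagram m n) (b : Diagram m' n')
    (c : Diagram m'' n'') :
    cast (Nat.add_assoc _ _ _) (Nat.add_assoc _ _ _) (tensor (tensor a b) c) =
      tensor a (tensor b c) := by
  refine eq_of_states_eq ?_
  funext x y
  revert y
  simp only [forall_append]
  revert x
  simp only [forall_append]
  intro x x' x'' y y' y''
  rw [states_cast]
  rw [← Fin.append_assoc, ← Fin.append_assoc]
  simp only [states_tensor, mul_assoc]

theorem tensor_zero (a : Diagram m n) : tensor a (identity 0) = a := by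
  refine eq_of_states_eq ?_
  funext x y
  have h := states_tensor a (identity 0) x Fin.elim0 y Fin.elim0
  rw [Fin.append_elim0, Fin.append_elim0] at h
  rw [states_identity] at h
  simpa using h

/-- Reflection of a diagram in a horizontal line. -/
def flip (a : Diagram m n) : Diagram n m where
  rel := a.rel.comap Sum.swap
  pairing := by
    intro x
    refine ⟨(a.partner x.swap).swap, ⟨?_, ?_⟩, ?_⟩
    · intro h
      exact a.partner_ne x.swap ((Sum.swap_swap _).symm.trans (congrArg Sum.swap h))
    · rw [Setoid.comap_rel, Sum.swap_swap]
      exact a.rel_partner _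
    · rintro y ⟨hne, hy⟩
      rw [← a.eq_partner hy (fun h => hne ((Sum.swap_leftInverse.injective) h)), Sum.swap_swap]
  noncrossing := by
    have hp : ∀ x : Fin n ⊕ Fin m, pos x.swap = m + n - 1 - pos x := by
      rintro (i | i)
      · have := i.2; simp only [Sum.swap_inl, pos]; omega
      · have := i.2; simp only [Sum.swap_inr, pos]; omega
    intro w x y z hwx hxy hyz hwy hxz
    have := pos_lt z
    refine a.noncrossing z.swap y.swap x.swap w.swap ?_ ?_ ?_ (a.rel.symm hxz) (a.rel.symm hwy) <;>
      rw [hp, hp] <;> omega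

theorem states_flip (a : Diagram m n) : states a.flip = (states a).transpose := by
  classical
  ext y x
  have hs : ∀ u : Fin n ⊕ Fin m, Sum.elim y x u = Sum.elim x y u.swap := by
    rintro (u | u) <;> rfl
  have : a.flip.Compat y x ↔ a.Compat x y := by
    constructor
    · intro h u v huv
      rw [← u.swap_swap, ← v.swap_swap, ← hs, ← hs]
      refine h _ _ ?_
      change a.rel u.swap.swap v.swap.swap
      rwa [u.swap_swap, v.swap_swap]
    · intro h u v huv
      rw [hs, hs]
      exact h _ _ huv
  simp only [states, Matrix.transpose_apply, this]

theorem flip_stack (a : Diagram l m) (b : Diagram m n) :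
    loops a b = loops b.flip a.flip ∧ (stack a b).flip = stack b.flip a.flip := by
  refine eq_of_states ?_
  rw [← states_mul, states_flip, states_flip, states_flip, ← Matrix.transpose_mul, states_mul,
    Matrix.transpose_smul]

theorem flip_flip (a : Diagram m n) : a.flip.flip = a :=
  eq_of_states_eq (by rw [states_flip, states_flip, Matrix.transpose_transpose])

theorem flip_identity : (identity n).flip = identity n :=
  eq_of_states_eq (by rw [states_flip, states_identity, Matrix.transpose_one])

theorem flip_tensor {m' n' : ℕ} (a : Diagram m n) (b : Diagram m' n') :
    (tensor a b).flip = tensor a.flip b.flip := by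
  refine eq_of_states_eq ?_
  funext x z
  revert z
  rw [forall_append]
  revert x
  rw [forall_append]
  intro x x' z z'
  simp only [states_flip, Matrix.transpose_apply, states_tensor]

/-! ### Cups and caps -/

theorem states_cap (x : Fin 0 → Bool) (y : Fin 2 → Bool) :
    states cap x y = if y 0 = y 1 then 1 else 0 := by
  classical
  refine if_congr ?_ rfl rfl
  constructor
  · exact fun h => h (.inr 0) (.inr 1) trivial
  · rintro h (u | u) (v | v) -
    · exact u.elim0
    · exact u.elim0
    · exact v.elim0
    · fin_cases u <;> fin_cases v <;> simp [h]

theorem states_cup (x : Fin 2 → Bool) (y : Fin 0 → Bool) :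
    states cup x y = if x 0 = x 1 then 1 else 0 := by
  classical
  refine if_congr ?_ rfl rfl
  constructor
  · exact fun h => h (.inl 0) (.inl 1) trivial
  · rintro h (u | u) (v | v) -
    · fin_cases u <;> fin_cases v <;> simp [h]
    · exact v.elim0
    · exact u.elim0
    · exact u.elim0

theorem flip_cap : cap.flip = cup :=
  eq_of_states_eq (by
    ext x y; rw [states_flip, Matrix.transpose_apply, states_cap, states_cup])

theorem stack_cap_cup : loops cap cup = 1 ∧ stack cap cup = identity 0 := by
  refine eq_of_states ?_
  rw [← states_mul, states_identity]
  ext x y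
  rw [Subsingleton.elim y x, Matrix.mul_apply, Matrix.smul_apply, Matrix.one_apply_eq]
  simp only [states_cap, states_cup]
  decide

/-- A zigzag is a straight strand. -/
theorem stack_zigzag :
    loops (l := 1) (m := 3) (n := 1) (tensor cap (identity 1)) (tensor (identity 1) cup) = 0 ∧
      stack (l := 1) (m := 3) (n := 1) (tensor cap (identity 1)) (tensor (identity 1) cup) =
        identity 1 := by
  have h1 : ∀ (x : Fin 1 → Bool) (z : Fin 3 → Bool), states (tensor cap (identity 1)) x z =
      if z 0 = z 1 ∧ x 0 = z 2 then 1 else 0 := by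
    intro x z
    have h := states_tensor cap (identity 1) Fin.elim0 x ![z 0, z 1] ![z 2]
    have ex : Fin.append Fin.elim0 x = x := by funext i; fin_cases i; rfl
    have ez : (Fin.append ![z 0, z 1] ![z 2] : Fin 3 → Bool) = z := by
      funext i; fin_cases i <;> rfl
    rw [ex, ez, states_cap, states_identity, Matrix.one_apply] at h
    rw [h]
    have : x = ![z 2] ↔ x 0 = z 2 :=
      ⟨fun h => by rw [h]; rfl, fun h => funext fun i => by fin_cases i; exact h⟩
    simp only [this]
    by_cases h1 : z 0 = z 1 <;> by_cases h2 : x 0 = z 2 <;> simp [h1, h2]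
  have h2 : ∀ (z : Fin 3 → Bool) (x : Fin 1 → Bool), states (tensor (identity 1) cup) z x =
      if z 0 = x 0 ∧ z 1 = z 2 then 1 else 0 := by
    intro z x
    have h := states_tensor (identity 1) cup ![z 0] ![z 1, z 2] x Fin.elim0
    have ex : Fin.append x Fin.elim0 = x := by funext i; fin_cases i; rfl
    have ez : (Fin.append ![z 0] ![z 1, z 2] : Fin 3 → Bool) = z := by
      funext i; fin_cases i <;> rfl
    rw [ex, ez, states_cup, states_identity, Matrix.one_apply] at h
    rw [h]
    have : ![z 0] = x ↔ z 0 = x 0 :=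
      ⟨fun h => by rw [← h]; rfl, fun h => funext fun i => by fin_cases i; exact h⟩
    simp only [this]
    by_cases h1 : z 0 = x 0 <;> by_cases h2 : z 1 = z 2 <;> simp [h1, h2]
  refine eq_of_states ?_
  rw [← states_mul, states_identity]
  ext x y
  rw [Matrix.mul_apply, Matrix.smul_apply, Matrix.one_apply]
  simp only [h1, h2]
  revert x y
  decide

/-! ### Partial traces of diagrams -/

/-- The `k` nested strands joining `2 k` bottom points: the points `j` and `2 k - 1 - j` are joined,
that is, the points with the same minimum of these two numbers. -/
def nest (k : ℕ) : Diagram 0 (k + k) where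
  rel := Setoid.ker (Sum.elim Fin.elim0 fun j => min (j : ℕ) (k + k - 1 - j))
  pairing := by
    rintro (i | i)
    · exact i.elim0
    · have hi := i.2
      refine ⟨.inr (Fin.rev i), ⟨?_, ?_⟩, ?_⟩
      · simp only [ne_eq, Sum.inr.injEq, Fin.ext_iff, Fin.val_rev]; omega
      · simp only [Setoid.ker_def, Sum.elim_inr, Fin.val_rev]; omega
      · rintro (j | j) ⟨hne, h⟩
        · exact j.elim0
        · simp only [Setoid.ker_def, Sum.elim_inr, ne_eq, Sum.inr.injEq, Fin.ext_iff,
            Fin.val_rev] at *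
          omega
  noncrossing := by
    rintro (w | w) (x | x) (y | y) (z | z) hwx hxy hyz hwy hxz
    all_goals first | exact w.elim0 | exact x.elim0 | exact y.elim0 | exact z.elim0 | skip
    rw [Setoid.ker_def] at hwy hxz
    simp only [Sum.elim_inr, pos] at *
    omega

theorem states_nest {k : ℕ} (x : Fin 0 → Bool) (s t : Fin k → Bool) :
    states (nest k) x (Fin.append s t) = if s = t ∘ Fin.rev then 1 else 0 := by
  classical
  refine if_congr ?_ rfl rfl
  have hrev : ∀ i : Fin k, Fin.append s t (Fin.rev (Fin.castAdd k i)) = t (Fin.rev i) := by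
    intro i
    rw [← Fin.append_right s t (Fin.rev i)]
    congr 1
    ext
    simp only [Fin.val_rev, Fin.val_castAdd, Fin.val_natAdd]
    omega
  constructor
  · intro h
    funext i
    have := h (.inr (Fin.castAdd k i)) (.inr (Fin.rev (Fin.castAdd k i))) (by
      have := i.2
      change min _ _ = min _ _
      simp only [Fin.val_rev, Fin.val_castAdd]
      omega)
    simpa [hrev] using this
  · intro h
    have hsymm : ∀ j, Fin.append s t (Fin.rev j) = Fin.append s t j := by
      refine fun j => Fin.addCases (fun i => ?_) (fun i => ?_) j
      · rw [hrev, Fin.append_left, h]; rfl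
      · have h2 := hrev (Fin.rev i)
        have h3 : Fin.rev (Fin.castAdd k (Fin.rev i)) = Fin.natAdd k i := by
          ext
          have := i.2
          simp only [Fin.val_rev, Fin.val_castAdd, Fin.val_natAdd]
          omega
        rw [← h3, Fin.rev_rev, h2, Fin.rev_rev, Fin.append_left, h]
        exact congrArg t (Fin.rev_rev i)
    rintro (u | u) (v | v) huv
    · exact u.elim0
    · exact u.elim0
    · exact v.elim0
    · replace huv : min (u : ℕ) (k + k - 1 - u) = min (v : ℕ) (k + k - 1 - v) := huv
      have hu := u.2
      have hv := v.2
      have : u = v ∨ u = Fin.rev v := by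
        simp only [Fin.ext_iff, Fin.val_rev]
        omega
      rcases this with rfl | rfl
      · rfl
      · exact hsymm v

/-- The diagram with `n` vertical strands followed by `k` nested strands at the bottom. -/
def bendRight (n k : ℕ) : Diagram n (n + k + k) :=
  cast (Nat.add_zero n) (Nat.add_assoc n k k).symm (tensor (identity n) (nest k))

/-- The diagram with `k` nested strands at the bottom followed by `n` vertical strands. -/
def bendLeft (k n : ℕ) : Diagram n (k + (k + n)) :=
  cast (Nat.zero_add n) (Nat.add_assoc k k n) (tensor (nest k) (identity n))

theorem states_bendRight {k : ℕ} (x y : Fin n → Bool) (s t : Fin k → Bool) :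
    states (bendRight n k) x (Fin.append (Fin.append y s) t) =
      (if x = y then 1 else 0) * (if s = t ∘ Fin.rev then 1 else 0) := by
  have e1 : x ∘ Fin.cast (Nat.add_zero n) = Fin.append x Fin.elim0 := by
    rw [Fin.append_elim0]
  have e2 : Fin.append (Fin.append y s) t ∘ Fin.cast (Nat.add_assoc n k k).symm =
      Fin.append y (Fin.append s t) := by
    rw [Fin.append_assoc]
    rfl
  rw [bendRight, states_cast, e1, e2, states_tensor, states_nest, states_identity,
    Matrix.one_apply]

theorem states_bendLeft {k : ℕ} (x y : Fin n → Bool) (s t : Fin k → Bool) :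
    states (bendLeft k n) x (Fin.append s (Fin.append t y)) =
      (if x = y then 1 else 0) * (if s = t ∘ Fin.rev then 1 else 0) := by
  have e1 : x ∘ Fin.cast (Nat.zero_add n) = Fin.append Fin.elim0 x := by
    rw [Fin.elim0_append]
  have e2 : Fin.append s (Fin.append t y) ∘ Fin.cast (Nat.add_assoc k k n) =
      Fin.append (Fin.append s t) y := by
    rw [Fin.append_assoc]
  rw [bendLeft, states_cast, e1, e2, states_tensor, states_nest, states_identity,
    Matrix.one_apply, mul_comm]

theorem rev_comp_inj {k : ℕ} (s t : Fin k → Bool) : s ∘ Fin.rev = t ∘ Fin.rev ↔ s = t :=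
  Fin.rev_surjective.injective_comp_right.eq_iff

/-- Closing the `k` rightmost strands of a diagram by nested strands to its right is a partial trace
of its matrix. -/
theorem states_partialTrace_right {k : ℕ} (c : Diagram (n + k) (m + k)) (x y) :
    (states (bendRight n k) * states (tensor c (identity k)) * (states (bendRight m k)).transpose)
      x y = ∑ s, states c (Fin.append x s) (Fin.append y s) := by
  simp only [Matrix.mul_apply, sum_append, Matrix.transpose_apply,
    states_bendRight, states_tensor, states_identity, Matrix.one_apply]
  simp only [ite_mul, one_mul, zero_mul, mul_ite, mul_one, mul_zero, Finset.sum_ite_eq,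
    Finset.mem_univ, ↓reduceIte, Finset.sum_ite_eq']
  refine (Finset.sum_congr rfl fun _ _ => Finset.sum_comm).trans ?_
  simp only [Finset.sum_ite_eq', Finset.mem_univ, ↓reduceIte]
  rw [Finset.sum_comm]
  simp only [Finset.sum_ite_eq, Finset.mem_univ, ↓reduceIte]
  exact (Equiv.arrowCongr Fin.revPerm (Equiv.refl Bool)).sum_comp
    fun s => states c (Fin.append x s) (Fin.append y s)

theorem states_partialTrace_left {k : ℕ} (c : Diagram (k + n) (k + m)) (x y) :
    (states (bendLeft k n) * states (tensor (identity k) c) * (states (bendLeft k m)).transpose)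
      x y = ∑ s, states c (Fin.append s x) (Fin.append s y) := by
  simp only [Matrix.mul_apply, sum_append, Matrix.transpose_apply,
    states_bendLeft, states_tensor, states_identity, Matrix.one_apply]
  simp only [ite_mul, one_mul, zero_mul, mul_ite, mul_one, mul_zero, Finset.sum_ite_eq,
    Finset.mem_univ, ↓reduceIte, Finset.sum_ite_irrel, Finset.sum_const_zero, Finset.sum_ite_eq']
  rw [Finset.sum_comm]
  simp only [Finset.sum_ite_eq', Finset.mem_univ, ↓reduceIte, rev_comp_inj]
  simp

theorem two_pow_loops_add_closureLoops (a : Diagram m n) (b : Diagram n m) :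
    2 ^ (loops a b + closureLoops (stack a b)) = ∑ x, ∑ y, states a x y * states b y x := by
  rw [pow_add, ← trace_states, ← smul_eq_mul, ← Matrix.trace_smul, ← states_mul]
  rfl

theorem two_pow_smul_states_stack {k : ℕ} (a : Diagram k l) (b : Diagram l m) (c : Diagram m n) :
    2 ^ (loops a b + loops (stack a b) c) • states (stack (stack a b) c) =
      states a * states b * states c := by
  rw [states_mul, Matrix.smul_mul, states_mul, smul_smul, pow_add]

/-- The trace of `(a ⊗ 1_k) ∘ c` is, up to some loops, the trace of `a`
composed with the diagram obtained from `c` by closing its `k` rightmost strands. -/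
theorem exists_partialTrace_right {k : ℕ} (c : Diagram (n + k) (m + k)) :
    ∃ (e : ℕ) (c' : Diagram n m), ∀ a : Diagram m n,
      loops c (tensor a (identity k)) + closureLoops (stack c (tensor a (identity k))) =
        e + (loops c' a + closureLoops (stack c' a)) := by
  refine ⟨loops (bendRight n k) (tensor c (identity k)) +
    loops (stack (bendRight n k) (tensor c (identity k))) (flip (bendRight m k)),
    stack (stack (bendRight n k) (tensor c (identity k))) (flip (bendRight m k)),
    fun a => Nat.pow_right_injective le_rfl ?_⟩
  have h : ∀ x y, _ = _ := fun x y => (congrFun (congrFun (two_pow_smul_states_stack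
    (bendRight n k) (tensor c (identity k)) (flip (bendRight m k))) x) y).trans
    (by rw [states_flip, states_partialTrace_right])
  simp only [Matrix.smul_apply, smul_eq_mul] at h
  change 2 ^ _ = 2 ^ _
  rw [pow_add 2 (_ + _), two_pow_loops_add_closureLoops, two_pow_loops_add_closureLoops]
  simp only [Finset.mul_sum, ← mul_assoc, h, sum_append, states_tensor, states_identity,
    Matrix.one_apply, Finset.sum_mul]
  simp only [mul_ite, mul_one, mul_zero, Finset.sum_ite_eq', Finset.mem_univ, ↓reduceIte]
  exact Finset.sum_congr rfl fun x _ => Finset.sum_comm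

/-- The version of `exists_partialTrace_right` for the `k` leftmost strands. -/
theorem exists_partialTrace_left {k : ℕ} (c : Diagram (k + n) (k + m)) :
    ∃ (e : ℕ) (c' : Diagram n m), ∀ a : Diagram m n,
      loops c (tensor (identity k) a) + closureLoops (stack c (tensor (identity k) a)) =
        e + (loops c' a + closureLoops (stack c' a)) := by
  refine ⟨loops (bendLeft k n) (tensor (identity k) c) +
    loops (stack (bendLeft k n) (tensor (identity k) c)) (flip (bendLeft k m)),
    stack (stack (bendLeft k n) (tensor (identity k) c)) (flip (bendLeft k m)),
    fun a => Nat.pow_right_injective le_rfl ?_⟩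
  have h : ∀ x y, _ = _ := fun x y => (congrFun (congrFun (two_pow_smul_states_stack
    (bendLeft k n) (tensor (identity k) c) (flip (bendLeft k m))) x) y).trans
    (by rw [states_flip, states_partialTrace_left])
  simp only [Matrix.smul_apply, smul_eq_mul] at h
  change 2 ^ _ = 2 ^ _
  rw [pow_add 2 (_ + _), two_pow_loops_add_closureLoops, two_pow_loops_add_closureLoops]
  simp only [Finset.mul_sum, ← mul_assoc, h, sum_append, states_tensor, states_identity,
    Matrix.one_apply, Finset.sum_mul]
  have hf : ∀ (x s : Fin k → Bool) (x_1 x_3) , (states c (Fin.append x x_1) (Fin.append s x_3) *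
      if s = x then 1 else 0) * states a x_3 x_1 =
      if s = x then states c (Fin.append x x_1) (Fin.append x x_3) * states a x_3 x_1 else 0 := by
    intro x s x_1 x_3
    split_ifs with h
    · rw [h, mul_one]
    · simp
  simp only [hf, Finset.sum_ite_irrel, Finset.sum_const_zero, Finset.sum_ite_eq', Finset.mem_univ,
    ↓reduceIte]
  rw [Finset.sum_comm]
  exact Finset.sum_congr rfl fun x _ => Finset.sum_comm

/-- Closing all strands of a diagram can begin with the rightmost strand. -/
theorem closureLoops_partialTrace {k : ℕ} (z : Diagram (n + k) (n + k)) :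
    loops (bendRight n k) (tensor z (identity k)) +
      loops (stack (bendRight n k) (tensor z (identity k))) (flip (bendRight n k)) +
      closureLoops (stack (stack (bendRight n k) (tensor z (identity k)))
        (flip (bendRight n k))) = closureLoops z := by
  refine Nat.pow_right_injective le_rfl ?_
  change 2 ^ _ = 2 ^ _
  rw [pow_add, ← trace_states, ← trace_states, ← smul_eq_mul, ← Matrix.trace_smul,
    two_pow_smul_states_stack, states_flip, Matrix.trace, Matrix.trace, sum_append]
  simp only [Matrix.diag_apply, states_partialTrace_right]

theorem nest_one : nest 1 = cap := by
  refine Diagram.ext (Setoid.ext fun u v => ⟨fun _ => trivial, fun _ => ?_⟩)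
  rcases u with u | u
  · exact u.elim0
  rcases v with v | v
  · exact v.elim0
  have hu := u.2
  have hv := v.2
  change min (u : ℕ) (1 + 1 - 1 - u) = min (v : ℕ) (1 + 1 - 1 - v)
  omega

theorem bendRight_one : bendRight n 1 = tensor (identity n) cap := by
  rw [bendRight, nest_one]
  rfl

/-! ### Adjacent pairs -/

/-- The colour of a single strand can be changed at will. -/
theorem compat_of_eq_off_pair (a : Diagram m n) {p q : Fin m ⊕ Fin n} (hpq : a.rel p q)
    (hne : q ≠ p) {φ ψ : Fin m ⊕ Fin n → Bool} (h : ∀ u v, a.rel u v → φ u = φ v)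
    (hoff : ∀ u, u ≠ p → u ≠ q → ψ u = φ u) (hψ : ψ p = ψ q) (u v) (huv : a.rel u v) :
    ψ u = ψ v := by
  by_cases hvu : v = u
  · rw [hvu]
  have hp : ∀ {w}, a.rel p w → w = p ∨ w = q := fun {w} hw => by
    by_cases h : w = p
    · exact .inl h
    · exact .inr (a.eq_of_rel hw hpq h hne)
  by_cases hu : a.rel p u
  · rcases hp hu with rfl | rfl <;> rcases hp (a.rel.trans hu huv) with rfl | rfl
    · rfl
    · exact hψ
    · exact hψ.symm
    · rfl
  · have hv : ¬ a.rel p v := fun h' => hu (a.rel.trans h' (a.rel.symm huv))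
    rw [hoff u, hoff v, h u v huv]
    · rintro rfl; exact hv (a.rel.refl _)
    · rintro rfl; exact hv hpq
    · rintro rfl; exact hu (a.rel.refl _)
    · rintro rfl; exact hu hpq

/-- The diagram with `i` vertical strands, a strand joining two bottom points, and `j` vertical
strands. -/
def capAt (i j : ℕ) : Diagram (i + 0 + j) (i + 2 + j) :=
  tensor (tensor (identity i) cap) (identity j)

theorem states_capAt {i j : ℕ} (x x' : _) (u : Fin 0 → Bool) (y y') (s : Fin 2 → Bool) :
    states (capAt i j) (Fin.append (Fin.append x u) x') (Fin.append (Fin.append y s) y') =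
      if x = y ∧ s 0 = s 1 ∧ x' = y' then 1 else 0 := by
  rw [capAt, states_tensor, states_tensor, states_identity, states_identity, states_cap,
    Matrix.one_apply, Matrix.one_apply]
  split_ifs <;> simp_all

/-- The bottom points with numbers `i` and `i + 1` are joined. -/
def AdjacentAt (i j : ℕ) (a : Diagram m (i + 2 + j)) : Prop :=
  a.rel (.inr (Fin.castAdd j (Fin.natAdd i 0))) (.inr (Fin.castAdd j (Fin.natAdd i 1)))

/-- If two adjacent bottom points are joined in `a`, then attaching the corresponding cup and cap
only creates a loop. -/
theorem stack_capAt {i j : ℕ} (a : Diagram m (i + 2 + j)) (h : AdjacentAt i j a) :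
    loops a (flip (capAt i j)) + loops (stack a (flip (capAt i j))) (capAt i j) = 1 ∧
      stack (stack a (flip (capAt i j))) (capAt i j) = a := by
  refine eq_of_states ?_
  rw [two_pow_smul_states_stack, states_flip, Matrix.mul_assoc]
  funext w z
  revert z
  simp only [forall_append]
  intro z s z'
  have hcompat : ∀ t t' : Fin 2 → Bool, t' 0 = t' 1 →
      a.Compat w (Fin.append (Fin.append z t) z') →
        a.Compat w (Fin.append (Fin.append z t') z') := by
    intro t t' ht' hc
    refine a.compat_of_eq_off_pair h ?_ hc ?_ ?_
    · simp [Fin.ext_iff]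
    · rintro (u | u) h0 h1
      · rfl
      · induction u using Fin.addCases with
        | right u => simp
        | left u =>
          induction u using Fin.addCases with
          | left u => simp
          | right u =>
            have : u = 0 ∨ u = 1 := by omega
            rcases this with rfl | rfl
            · exact absurd rfl h0
            · exact absurd rfl h1
    · simpa using ht'
  classical
  have key : ∀ t : Fin 2 → Bool, t 0 = t 1 → s 0 = s 1 →
      states a w (Fin.append (Fin.append z t) z') = states a w (Fin.append (Fin.append z s) z') :=
    fun t ht hs => if_congr (Iff.intro (hcompat t s hs) (hcompat s t ht)) rfl rfl
  have key' : s 0 ≠ s 1 → states a w (Fin.append (Fin.append z s) z') = 0 := by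
    intro hs
    refine if_neg fun hc => hs ?_
    simpa using hc _ _ h
  simp only [Matrix.mul_apply, sum_append, Matrix.transpose_apply, states_capAt]
  by_cases hs : s 0 = s 1
  · simp only [hs, ite_and, mul_ite, mul_one, mul_zero,
      Finset.sum_ite_irrel, Finset.sum_const_zero, Finset.sum_ite_eq, Finset.sum_ite_eq',
      Finset.mem_univ, ↓reduceIte]
    refine (Finset.sum_congr rfl fun t _ => ?_).trans
      (b := ∑ t : Fin 2 → Bool, if t 0 = t 1 then
        states a w (Fin.append (Fin.append z s) z') else 0) ?_
    · split_ifs with ht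
      · rw [key t ht hs]
        simp
      · rfl
    · rw [← Finset.sum_filter, Finset.sum_const, Matrix.smul_apply, pow_one]
      congr 1
  · simp [hs, key' hs]

/-! ### Diagrams without adjacent pairs -/

/-- Inside a strand joining two bottom points there is an innermost one, which joins adjacent
points. -/
theorem exists_adjacent (a : Diagram m n) {i j : Fin n} (hij : i < j)
    (h : a.rel (.inr i) (.inr j)) :
    ∃ (p : ℕ) (hp : p + 1 < n), a.rel (.inr ⟨p, by omega⟩) (.inr ⟨p + 1, hp⟩) := by
  induction hd : (j : ℕ) - i using Nat.strong_induction_on generalizing i j with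
  | _ d ih =>
    have hi := i.2
    have hj := j.2
    have hij' : (i : ℕ) < j := hij
    by_cases hadj : (i : ℕ) + 1 = j
    · refine ⟨i, by omega, ?_⟩
      convert h
    · -- by planarity, the strand starting next to `i` stays inside the strand from `i` to `j`
      let k : Fin n := ⟨i + 1, by omega⟩
      have hk : (k : ℕ) = i + 1 := rfl
      have hr := a.rel_partner (.inr k)
      have hne := a.partner_ne (.inr k)
      generalize a.partner (.inr k) = y at hr hne
      have hki : k ≠ i := fun e => by rw [e] at hk; omega
      have hkj : k ≠ j := fun e => by rw [e] at hk; omega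
      have hyi : y ≠ .inr i := by
        rintro rfl
        exact hkj (Sum.inr_injective (a.eq_of_rel (a.rel.symm hr) h (by simpa using hki)
          (by simpa using hij.ne')))
      have hyj : y ≠ .inr j := by
        rintro rfl
        exact hki (Sum.inr_injective (a.eq_of_rel (a.rel.symm hr) (a.rel.symm h)
          (by simpa using hkj) (by simpa using hij.ne)))
      have h1 : ¬ pos y < pos (.inr j : Fin m ⊕ Fin n) := fun hlt =>
        a.noncrossing y (.inr j) (.inr k) (.inr i) hlt (by simp only [pos]; omega)
          (by simp only [pos]; omega) (a.rel.symm hr) (a.rel.symm h)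
      have h2 : ¬ pos (.inr i : Fin m ⊕ Fin n) < pos y := fun hlt =>
        a.noncrossing (.inr j) (.inr k) (.inr i) y (by simp only [pos]; omega)
          (by simp only [pos]; omega) hlt (a.rel.symm h) hr
      rcases y with p | p
      · simp only [pos] at h1
        have := p.2
        omega
      · have hp := p.2
        simp only [pos] at h1 h2
        have hpi : (p : ℕ) ≠ i := fun e => hyi (congrArg _ (Fin.ext e))
        have hpj : (p : ℕ) ≠ j := fun e => hyj (congrArg _ (Fin.ext e))
        have hpk : (p : ℕ) ≠ k := fun e => hne (congrArg _ (Fin.ext e))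
        exact ih ((p : ℕ) - k) (by omega) (i := k) (j := p) (show (k : ℕ) < p by omega) hr rfl

theorem eq_of_rel_le {a b : Diagram m n} (h : ∀ u v, a.rel u v → b.rel u v) : a = b := by
  refine Diagram.ext (Setoid.ext fun u v => ⟨h u v, fun huv => ?_⟩)
  by_cases hvu : v = u
  · rw [hvu]
  · rw [b.eq_of_rel huv (h _ _ (a.rel_partner u)) hvu (a.partner_ne u)]
    exact a.rel_partner u

/-- If all strands go from the top to the bottom then they are vertical. -/
theorem exists_eq_identity (a : Diagram m n) (htop : ∀ i j : Fin m, a.rel (.inl i) (.inl j) → i = j)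
    (hbot : ∀ i j : Fin n, a.rel (.inr i) (.inr j) → i = j) :
    ∃ h : m = n, a = cast h.symm rfl (identity n) := by
  have hf : ∀ i : Fin m, ∃ j : Fin n, a.rel (.inl i) (.inr j) := by
    intro i
    have hr := a.rel_partner (.inl i)
    have hne := a.partner_ne (.inl i)
    generalize a.partner (.inl i) = y at hr hne
    rcases y with j | j
    · exact absurd (congrArg _ (htop _ _ hr).symm) hne
    · exact ⟨j, hr⟩
  choose f hf using hf
  have hmono : StrictMono f := by
    intro i i' hii
    by_contra hlt
    have hne : f i ≠ f i' := fun e => hii.ne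
      (htop _ _ (a.rel.trans (hf i) (e ▸ a.rel.symm (hf i'))))
    have hlt' : f i' < f i := lt_of_le_of_ne (not_lt.1 hlt) hne.symm
    have h1 : (f i' : ℕ) < f i := hlt'
    have h2 := (f i).2
    have h3 := i'.2
    exact a.noncrossing (.inl i) (.inl i') (.inr (f i)) (.inr (f i')) hii
      (by simp only [pos]; omega) (by simp only [pos]; omega) (hf i) (hf i')
  have hsurj : Function.Surjective f := by
    intro j
    have hr := a.rel_partner (.inr j)
    have hne := a.partner_ne (.inr j)
    generalize a.partner (.inr j) = y at hr hne
    rcases y with i | i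
    · exact ⟨i, hbot _ _ (a.rel.symm (a.rel.trans hr (hf i)))⟩
    · exact absurd (congrArg _ (hbot _ _ hr).symm) hne
  have hmn : m = n := by
    simpa using Fintype.card_congr (Equiv.ofBijective f ⟨hmono.injective, hsurj⟩)
  subst hmn
  refine ⟨rfl, eq_of_rel_le ?_⟩
  have hid : ∀ i, f i = i := fun i => by
    have := Subsingleton.elim (hmono.orderIsoOfSurjective f hsurj) (OrderIso.refl _)
    exact congrArg (fun e : Fin m ≃o Fin m => e i) this
  have hrel : ∀ i j, a.rel (.inl i) (.inr j) → i = j := fun i j h => by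
    rw [hbot _ _ (a.rel.trans (a.rel.symm h) (hf i)), hid]
  rintro (i | i) (j | j) h
  · exact htop _ _ h
  · exact hrel _ _ h
  · exact (hrel _ _ (a.rel.symm h)).symm
  · exact hbot _ _ h

/-- Each diagram has two adjacent bottom points that are joined, or two adjacent top points, or is
an identity. -/
theorem cases_adjacent {motive : ∀ m n, Diagram m n → Prop}
    (hid : ∀ n, motive n n (identity n))
    (hbot : ∀ m i j (a : Diagram m (i + 2 + j)), AdjacentAt i j a → motive m (i + 2 + j) a)
    (htop : ∀ n i j (a : Diagram (i + 2 + j) n), AdjacentAt i j a.flip → motive (i + 2 + j) n a)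
    (a : Diagram m n) : motive m n a := by
  have key : ∀ {m n} (a : Diagram m n), (∃ i j : Fin n, a.rel (.inr i) (.inr j) ∧ i ≠ j) →
      ∃ (p : ℕ) (hp : p + 1 < n), a.rel (.inr ⟨p, by omega⟩) (.inr ⟨p + 1, hp⟩) := by
    rintro m n a ⟨i, j, h, hne⟩
    rcases lt_or_gt_of_ne hne with hlt | hlt
    · exact a.exists_adjacent hlt h
    · exact a.exists_adjacent hlt (a.rel.symm h)
  by_cases hb : ∃ i j : Fin n, a.rel (.inr i) (.inr j) ∧ i ≠ j
  · obtain ⟨p, hp, h⟩ := key a hb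
    obtain ⟨j, rfl⟩ : ∃ j, n = p + 2 + j := ⟨n - (p + 2), by omega⟩
    exact hbot m p j a h
  by_cases ht : ∃ i j : Fin m, a.flip.rel (.inr i) (.inr j) ∧ i ≠ j
  · obtain ⟨p, hp, h⟩ := key a.flip ht
    obtain ⟨j, rfl⟩ : ∃ j, m = p + 2 + j := ⟨m - (p + 2), by omega⟩
    exact htop n p j a h
  push Not at hb ht
  obtain ⟨rfl, rfl⟩ := a.exists_eq_identity ht hb
  exact hid m

end Diagram

/-! ### Composition and tensor product of morphisms -/

section Hom

variable {K : Type*} [Field K] {d : K} {k l m n : ℕ}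

theorem comp_of (b : Diagram m n) (a : Diagram l m) :
    comp d (Hom.of K b) (Hom.of K a) = d ^ Diagram.loops a b • Hom.of K (Diagram.stack a b) := by
  simp [comp, Hom.of]

theorem tensor_of {m' n' : ℕ} (a : Diagram m n) (b : Diagram m' n') :
    tensor (Hom.of K a) (Hom.of K b) = Hom.of K (Diagram.tensor a b) := by
  simp [tensor, Hom.of]

theorem trace_of (a : Diagram n n) : trace d (Hom.of K a) = d ^ a.closureLoops := by
  simp [trace, Hom.of]

theorem hom_induction {p : Hom K m n → Prop} (x : Hom K m n) (h0 : p 0)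
    (hadd : ∀ x y, p x → p y → p (x + y)) (hof : ∀ (c : K) a, p (c • Hom.of K a)) : p x := by
  induction x using Finsupp.induction_linear with
  | zero => exact h0
  | add x y hx hy => exact hadd x y hx hy
  | single a c => simpa [Hom.of] using hof c a

theorem comp_assoc (c : Hom K m n) (b : Hom K l m) (a : Hom K k l) :
    comp d (comp d c b) a = comp d c (comp d b a) := by
  induction c using hom_induction with
  | h0 => simp
  | hadd x y hx hy => simp [hx, hy]
  | hof z c =>
  induction b using hom_induction with
  | h0 => simp
  | hadd x y hx hy => simp only [map_add, LinearMap.add_apply, hx, hy]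
  | hof z' b =>
  induction a using hom_induction with
  | h0 => simp
  | hadd x y hx hy => simp only [map_add, hx, hy]
  | hof z'' a =>
    obtain ⟨h1, h2⟩ := Diagram.stack_assoc a b c
    simp only [map_smul, LinearMap.smul_apply, comp_of, smul_smul, ← h2]
    congr 1
    linear_combination (z * z' * z'') * (congrArg (d ^ ·) h1).symm

theorem one_comp (a : Hom K m n) : comp d (one K n) a = a := by
  induction a using hom_induction with
  | h0 => simp
  | hadd x y hx hy => simp [hx, hy]
  | hof z a => simp [one, comp_of, Diagram.stack_identity]

theorem comp_one (a : Hom K m n) : comp d a (one K m) = a := by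
  induction a using hom_induction with
  | h0 => simp
  | hadd x y hx hy => simp [hx, hy]
  | hof z a => simp [one, comp_of, Diagram.identity_stack]

/-- The interchange law. -/
theorem tensor_comp {l' m' n' : ℕ} (b : Hom K m n) (a : Hom K l m) (b' : Hom K m' n')
    (a' : Hom K l' m') :
    comp d (tensor b b') (tensor a a') = tensor (comp d b a) (comp d b' a') := by
  induction b using hom_induction with
  | h0 => simp
  | hadd x y hx hy => simp [hx, hy]
  | hof z b =>
  induction a using hom_induction with
  | h0 => simp
  | hadd x y hx hy => simp only [map_add, LinearMap.add_apply, hx, hy]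
  | hof z' a =>
  induction b' using hom_induction with
  | h0 => simp
  | hadd x y hx hy => simp only [map_add, LinearMap.add_apply, hx, hy]
  | hof z'' b' =>
  induction a' using hom_induction with
  | h0 => simp
  | hadd x y hx hy => simp only [map_add, hx, hy]
  | hof z''' a' =>
    obtain ⟨h1, h2⟩ := Diagram.tensor_stack a b a' b'
    simp only [map_smul, LinearMap.smul_apply, comp_of, tensor_of, smul_smul, h2]
    rw [h1]
    congr 1
    ring

theorem tensor_one_one : tensor (one K m) (one K n) = one K (m + n) := by
  rw [one, one, tensor_of, Diagram.tensor_identity, one]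

theorem trace_comp_comm (a : Hom K m n) (b : Hom K n m) :
    trace d (comp d a b) = trace d (comp d b a) := by
  induction a using hom_induction with
  | h0 => simp
  | hadd x y hx hy => simp [hx, hy]
  | hof z a =>
  induction b using hom_induction with
  | h0 => simp
  | hadd x y hx hy => simp only [map_add, LinearMap.add_apply, hx, hy]
  | hof z' b =>
    simp only [map_smul, LinearMap.smul_apply, comp_of, trace_of, smul_smul, smul_eq_mul]
    have h := congrArg (d ^ ·) (Diagram.closureLoops_comm a b)
    simp only [pow_add] at h
    linear_combination (-z * z') * h

theorem tensor_one_zero (a : Hom K m n) : tensor a (one K 0) = a := by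
  induction a using hom_induction with
  | h0 => simp
  | hadd x y hx hy =>
    rw [map_add, LinearMap.add_apply, hx, hy]
  | hof z a => rw [map_smul, LinearMap.smul_apply, one, tensor_of, Diagram.tensor_zero]

theorem tensor_one_succ (a : Hom K m n) (j : ℕ) :
    tensor a (one K (j + 1)) = tensor (tensor a (one K j)) (one K 1) := by
  rw [← tensor_one_one (m := j) (n := 1)]
  induction a using hom_induction with
  | h0 => simp
  | hadd x y hx hy =>
    rw [map_add, LinearMap.add_apply, hx, hy, map_add, LinearMap.add_apply, map_add,
      LinearMap.add_apply]
  | hof z a =>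
    rw [map_smul, LinearMap.smul_apply, map_smul, LinearMap.smul_apply, map_smul,
      LinearMap.smul_apply, one, one, tensor_of, tensor_of, tensor_of, tensor_of,
      ← Diagram.tensor_assoc]
    rfl

/-! ### Reflection of morphisms -/

/-- The linear extension of the reflection of diagrams in a horizontal line. -/
noncomputable def flip : Hom K m n →ₗ[K] Hom K n m :=
  Finsupp.linearCombination K fun a : Diagram m n => Hom.of K a.flip

theorem flip_of (a : Diagram m n) : flip (Hom.of K a) = Hom.of K a.flip := by
  simp [flip, Hom.of]

theorem flip_flip (a : Hom K m n) : flip (flip a) = a := by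
  induction a using hom_induction with
  | h0 => simp
  | hadd x y hx hy => simp only [map_add, hx, hy]
  | hof z a => simp only [map_smul, flip_of, Diagram.flip_flip]

theorem flip_comp (b : Hom K m n) (a : Hom K l m) :
    flip (comp d b a) = comp d (flip a) (flip b) := by
  induction b using hom_induction with
  | h0 => simp
  | hadd x y hx hy => simp [hx, hy]
  | hof z b =>
  induction a using hom_induction with
  | h0 => simp
  | hadd x y hx hy => simp only [map_add, LinearMap.add_apply, hx, hy]
  | hof z' a =>
    obtain ⟨h1, h2⟩ := Diagram.flip_stack a b
    simp only [map_smul, LinearMap.smul_apply, comp_of, flip_of, smul_smul, h1, h2]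
    congr 1
    ring

theorem flip_tensor {m' n' : ℕ} (a : Hom K m n) (b : Hom K m' n') :
    flip (tensor a b) = tensor (flip a) (flip b) := by
  induction a using hom_induction with
  | h0 => simp
  | hadd x y hx hy => simp only [map_add, LinearMap.add_apply, hx, hy]
  | hof z a =>
  induction b using hom_induction with
  | h0 => simp
  | hadd x y hx hy => simp only [map_add, hx, hy]
  | hof z' b =>
    simp only [map_smul, LinearMap.smul_apply, tensor_of, flip_of, Diagram.flip_tensor]

theorem flip_one : flip (one K n) = one K n := by
  rw [one, flip_of, Diagram.flip_identity]

end Hom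

/-! ### Cups and caps as morphisms -/

section Cups

variable {K : Type*} [Field K] {d : K} {l m n : ℕ}

/-- The morphism with `n` vertical strands followed by a strand joining two bottom points. -/
noncomputable def capRight (K : Type*) [Field K] (n : ℕ) : Hom K n (n + 2) :=
  tensor (one K n) (Hom.of K Diagram.cap)

/-- The morphism with `n` vertical strands followed by a strand joining two top points. -/
noncomputable def cupRight (K : Type*) [Field K] (n : ℕ) : Hom K (n + 2) n :=
  tensor (one K n) (Hom.of K Diagram.cup)

theorem flip_capRight : flip (capRight K n) = cupRight K n := by
  rw [capRight, cupRight]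
  refine (flip_tensor _ _).trans ?_
  rw [flip_one, flip_of, Diagram.flip_cap]

theorem flip_cupRight : flip (cupRight K n) = capRight K n := by
  rw [← flip_capRight, flip_flip]

theorem tensor_one_cap_comp_cup :
    (tensor (one K n) (comp d (Hom.of K Diagram.cap) (Hom.of K Diagram.cup)) :
      Hom K (n + 2) (n + 2)) = comp d (capRight K n) (cupRight K n) := by
  refine Eq.trans ?_ (tensor_comp _ _ _ _).symm
  rw [one_comp]

theorem cupRight_comp_capRight : comp d (cupRight K n) (capRight K n) = d • one K n := by
  refine (tensor_comp (one K n) (one K n) (Hom.of K Diagram.cup) (Hom.of K Diagram.cap)).trans ?_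
  rw [one_comp, comp_of, Diagram.stack_cap_cup.1, Diagram.stack_cap_cup.2, map_smul, pow_one]
  exact congrArg (fun b : Hom K n n => d • b) (tensor_one_zero (one K n))

theorem cupRight_comp_tensor (a : Hom K m n) :
    comp d (cupRight K n) (tensor a (one K 2)) = comp d a (cupRight K m) := by
  refine (tensor_comp _ _ _ _).trans ?_
  rw [one_comp, comp_one]
  conv_lhs => rw [← comp_one (d := d) a, ← one_comp (d := d) (Hom.of K Diagram.cup)]
  rw [← tensor_comp]
  exact congrArg (fun b => comp d b _) (tensor_one_zero a)

theorem tensor_comp_capRight (a : Hom K m n) :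
    comp d (tensor a (one K 2)) (capRight K m) = comp d (capRight K n) a := by
  have h := congrArg flip (cupRight_comp_tensor (d := d) (flip a))
  rw [flip_comp, flip_comp, flip_cupRight, flip_cupRight, flip_tensor, flip_flip, flip_one] at h
  exact h

theorem cupRight_comp_capRight_tensor :
    comp d (cupRight K (n + 1)) (tensor (capRight K n) (one K 1)) = one K (n + 1) := by
  have h1 : cupRight K (n + 1) =
      tensor (one K n) (Hom.of K (Diagram.tensor (Diagram.identity 1) Diagram.cup)) := by
    rw [cupRight, one, one, tensor_of, ← Diagram.tensor_identity]
    exact (congrArg (Hom.of K) (Diagram.tensor_assoc (Diagram.identity n) (Diagram.identity 1)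
      Diagram.cup)).trans (tensor_of _ _).symm
  have h2 : tensor (capRight K n) (one K 1) =
      tensor (one K n) (Hom.of K (Diagram.tensor Diagram.cap (Diagram.identity 1))) := by
    rw [capRight, one, one, tensor_of, tensor_of, tensor_of]
    exact congrArg (Hom.of K) (Diagram.tensor_assoc (Diagram.identity n) Diagram.cap
      (Diagram.identity 1))
  rw [h1, h2]
  refine (tensor_comp _ _ _ _).trans ?_
  rw [one_comp]
  refine (congrArg _ ((comp_of _ _).trans ?_)).trans (tensor_one_one (m := n) (n := 1))
  rw [Diagram.stack_zigzag.1, Diagram.stack_zigzag.2, pow_zero, one_smul, one]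

theorem cupRight_tensor_comp_capRight :
    comp d (tensor (cupRight K n) (one K 1)) (capRight K (n + 1)) = one K (n + 1) := by
  have h := congrArg flip (cupRight_comp_capRight_tensor (K := K) (d := d) (n := n))
  have h' : flip (tensor (capRight K n) (one K 1)) = tensor (cupRight K n) (one K 1) := by
    rw [flip_tensor, flip_one, flip_capRight]
  rw [flip_comp, flip_cupRight, flip_one] at h
  exact (congrArg (fun b => comp d b (capRight K (n + 1))) h').symm.trans h

/-- The Markov property of the trace. -/
theorem trace_partialTrace (z : Hom K (n + 1) (n + 1)) :
    trace d (comp d (cupRight K n) (comp d (tensor z (one K 1)) (capRight K n))) = trace d z := by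
  have hcap : capRight K n = Hom.of K (Diagram.bendRight n 1) := by
    rw [Diagram.bendRight_one, ← tensor_of]; rfl
  have hcup : cupRight K n = Hom.of K (Diagram.bendRight n 1).flip := by
    rw [← flip_of, ← hcap, flip_capRight]
  induction z using hom_induction with
  | h0 => simp
  | hadd x y hx hy => simp only [map_add, LinearMap.add_apply, hx, hy]
  | hof c z =>
    rw [hcap, hcup]
    simp only [map_smul, LinearMap.smul_apply, one, tensor_of, comp_of, trace_of, smul_eq_mul,
      ← Diagram.closureLoops_partialTrace z, pow_add]
    ring

end Cups

/-! ### Jones–Wenzl idempotents over a field -/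

section JonesWenzl

variable {K : Type*} [Field K]

/-- The Jones–Wenzl element on `n` strands with parameter `t`, by Wenzl's recursion. It is
meaningful if the quantum integers `[k]` with `1 ≤ k ≤ n` do not vanish at `t`. -/
noncomputable def jw (t : K) : (n : ℕ) → Hom K n n
  | 0 => one K 0
  | 1 => one K 1
  | n + 2 =>
    tensor (jw t (n + 1)) (one K 1) - (quantumInt t (n + 1) / quantumInt t (n + 2)) •
      comp (loopValue t) (tensor (jw t (n + 1)) (one K 1))
        (comp (loopValue t) (comp (loopValue t) (capRight K n) (cupRight K n))
          (tensor (jw t (n + 1)) (one K 1)))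

theorem jonesWenzl_eq_jw (n : ℕ) : jonesWenzl n = jw RatFunc.X n := by
  induction n using jw.induct with
  | case1 => rfl
  | case2 => rfl
  | case3 n ih => rw [jonesWenzl, jw, ih, tensor_one_cap_comp_cup]

variable {t : K} {N m n : ℕ}

theorem flip_jw (n : ℕ) : flip (jw t n) = jw t n := by
  induction n using jw.induct with
  | case1 => exact flip_one
  | case2 => exact flip_one
  | case3 n ih =>
    have h : flip (tensor (jw t (n + 1)) (one K 1)) = tensor (jw t (n + 1)) (one K 1) := by
      rw [flip_tensor, ih, flip_one]
    rw [jw, map_sub, map_smul, flip_comp, flip_comp, flip_comp, h, flip_capRight, flip_cupRight,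
      comp_assoc]

theorem quantumInt_one (h : t - t⁻¹ ≠ 0) : quantumInt t 1 = 1 := by
  rw [quantumInt, pow_one, pow_one, div_self h]

theorem sub_inv_ne_zero_of_quantumInt {k : ℕ} (h : quantumInt t k ≠ 0) : t - t⁻¹ ≠ 0 := by
  intro h0
  rw [quantumInt, h0, div_zero] at h
  exact h rfl

theorem loopValue_mul_quantumInt (ht : t ≠ 0) (n : ℕ) :
    loopValue t * quantumInt t (n + 1) = quantumInt t (n + 2) + quantumInt t n := by
  rw [loopValue, quantumInt, quantumInt, quantumInt, ← add_div, mul_div_assoc']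
  congr 1
  have h : t * t⁻¹ = 1 := mul_inv_cancel₀ ht
  linear_combination (t ^ n - t⁻¹ ^ n) * h

theorem loopValue_eq (ht : t ≠ 0) (h : t - t⁻¹ ≠ 0) : loopValue t = quantumInt t 2 := by
  have := loopValue_mul_quantumInt ht 0
  rw [zero_add, quantumInt_one h, mul_one] at this
  rw [this]
  simp [quantumInt]

theorem jw_absorb (h : comp (loopValue t) (jw t n) (jw t n) = jw t n) :
    comp (loopValue t) (tensor (jw t n) (one K 1)) (jw t (n + 1)) = jw t (n + 1) := by
  cases n with
  | zero =>
    rw [jw, jw]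
    refine (congrArg (fun b => comp _ b _) (tensor_one_one (m := 0) (n := 1))).trans ?_
    exact one_comp _
  | succ n =>
    have hP : comp (loopValue t) (tensor (jw t (n + 1)) (one K 1))
        (tensor (jw t (n + 1)) (one K 1)) = tensor (jw t (n + 1)) (one K 1) := by
      rw [tensor_comp, h, one_comp]
    rw [jw, map_sub, map_smul, ← comp_assoc (tensor (jw t (n + 1)) (one K 1)), hP]

/-- The partial trace of a Jones–Wenzl idempotent. -/
theorem partialTrace_jw (ht : t ≠ 0) (hn : quantumInt t (n + 1) ≠ 0)
    (h : comp (loopValue t) (jw t n) (jw t n) = jw t n) :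
    comp (loopValue t) (cupRight K n) (comp (loopValue t) (tensor (jw t (n + 1)) (one K 1))
      (capRight K n)) = (quantumInt t (n + 2) / quantumInt t (n + 1)) • jw t n := by
  have h0 := sub_inv_ne_zero_of_quantumInt hn
  cases n with
  | zero =>
    have e : quantumInt t (0 + 2) / quantumInt t (0 + 1) = loopValue t := by
      rw [zero_add, zero_add, quantumInt_one h0, div_one, loopValue_eq ht h0]
    rw [e, jw, jw, ← cupRight_comp_capRight]
    refine congrArg _ ?_
    refine (congrArg (fun b => comp _ b _) (tensor_one_one (m := 1) (n := 1))).trans ?_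
    exact one_comp _
  | succ n =>
    set d := loopValue t with hd
    have e2 : tensor (tensor (jw t (n + 1)) (one K 1)) (one K 1) =
        tensor (jw t (n + 1)) (one K 2) := (tensor_one_succ _ 1).symm
    have e3 : ∀ a b c : Hom K (n + 2) (n + 2), tensor (comp d a (comp d b c)) (one K 1) =
        comp d (tensor a (one K 1)) (comp d (tensor b (one K 1)) (tensor c (one K 1))) := by
      intro a b c
      rw [tensor_comp, tensor_comp, one_comp, one_comp]
    have e4 : tensor (comp d (capRight K n) (cupRight K n)) (one K 1) =
        comp d (tensor (capRight K n) (one K 1)) (tensor (cupRight K n) (one K 1)) := by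
      rw [tensor_comp, one_comp]
    have hc : d - quantumInt t (n + 1) / quantumInt t (n + 2) =
        quantumInt t (n + 1 + 2) / quantumInt t (n + 1 + 1) := by
      have := loopValue_mul_quantumInt ht (n + 1)
      rw [eq_div_iff hn, sub_mul, div_mul_cancel₀ _ hn]
      rw [← hd] at this
      linear_combination this
    rw [← hc]
    conv_lhs => rw [jw, map_sub, map_smul, LinearMap.sub_apply, LinearMap.smul_apply, e3, e4, e2,
      map_sub, map_smul, LinearMap.sub_apply, LinearMap.smul_apply, map_sub, map_smul,
      tensor_comp_capRight]
    -- after pulling the two copies of `p ⊗ 1_2` through the cup and the cap, two zigzags remain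
    have key : comp d (cupRight K (n + 1)) (comp d (comp d (tensor (jw t (n + 1)) (one K 2))
        (comp d (comp d (tensor (capRight K n) (one K 1)) (tensor (cupRight K n) (one K 1)))
          (tensor (jw t (n + 1)) (one K 2)))) (capRight K (n + 1))) = jw t (n + 1) := by
      rw [comp_assoc, comp_assoc, tensor_comp_capRight, ← comp_assoc (cupRight K (n + 1)),
        cupRight_comp_tensor, comp_assoc, comp_assoc, ← comp_assoc (cupRight K (n + 1)),
        cupRight_comp_capRight_tensor, one_comp, ← comp_assoc _ (capRight K (n + 1)),
        cupRight_tensor_comp_capRight, one_comp, h]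
    rw [sub_smul]
    refine congrArg₂ _ ?_ (congrArg _ key)
    rw [← comp_assoc, cupRight_comp_capRight, map_smul, LinearMap.smul_apply, one_comp]

/-- The coefficient in Wenzl's recursion is the inverse of the factor in `partialTrace_jw`, so that
the two terms cancel below a cup. -/
theorem cupRight_comp_jw_of_idem (ht : t ≠ 0) (hn : quantumInt t (n + 1) ≠ 0)
    (hn' : quantumInt t (n + 2) ≠ 0) (h : comp (loopValue t) (jw t n) (jw t n) = jw t n) :
    comp (loopValue t) (cupRight K n) (jw t (n + 2)) = 0 := by
  have habs : comp (loopValue t) (tensor (jw t n) (one K 2))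
      (tensor (jw t (n + 1)) (one K 1)) = tensor (jw t (n + 1)) (one K 1) := by
    rw [tensor_one_succ (jw t n) 1]
    refine (tensor_comp _ _ _ _).trans ?_
    rw [one_comp, jw_absorb h]
  have key : comp (loopValue t) (cupRight K n)
      (comp (loopValue t) (tensor (jw t (n + 1)) (one K 1))
      (comp (loopValue t) (comp (loopValue t) (capRight K n) (cupRight K n))
      (tensor (jw t (n + 1)) (one K 1)))) = (quantumInt t (n + 2) / quantumInt t (n + 1)) •
      comp (loopValue t) (cupRight K n) (tensor (jw t (n + 1)) (one K 1)) := by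
    rw [comp_assoc, ← comp_assoc _ (capRight K n), ← comp_assoc (cupRight K n),
      partialTrace_jw ht hn h, map_smul, LinearMap.smul_apply, ← comp_assoc,
      ← cupRight_comp_tensor, comp_assoc, habs]
  rw [jw, map_sub, map_smul, key, smul_smul, div_mul_div_cancel₀ hn', div_self hn, one_smul,
    sub_self]

theorem jw_comp_jw (ht : t ≠ 0) (hN : ∀ k, 1 ≤ k → k ≤ N → quantumInt t k ≠ 0) (n : ℕ)
    (hn : n ≤ N) : comp (loopValue t) (jw t n) (jw t n) = jw t n := by
  induction n using Nat.strong_induction_on with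
  | _ n ih =>
    match n, hn, ih with
    | 0, _, _ => exact one_comp _
    | 1, _, _ => exact one_comp _
    | n + 2, hn, ih =>
      have h0 := ih n (by omega) (by omega)
      have h1 := ih (n + 1) (by omega) (by omega)
      have hcup := cupRight_comp_jw_of_idem ht (hN (n + 1) (by omega) (by omega))
        (hN (n + 2) (by omega) hn) h0
      have habs : comp (loopValue t) (tensor (jw t (n + 1)) (one K 1)) (jw t (n + 2)) =
        jw t (n + 2) := jw_absorb h1
      conv_lhs => enter [1]; rw [jw]
      rw [map_sub, map_smul, LinearMap.sub_apply, LinearMap.smul_apply, comp_assoc, comp_assoc,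
        habs, comp_assoc, hcup, map_zero, map_zero, smul_zero, sub_zero]

theorem trace_jw (ht : t ≠ 0) (h0 : t - t⁻¹ ≠ 0)
    (hN : ∀ k, 1 ≤ k → k ≤ N → quantumInt t k ≠ 0) (n : ℕ)
    (hn : n ≤ N) : trace (loopValue t) (jw t n) = quantumInt t (n + 1) := by
  induction n with
  | zero =>
    rw [quantumInt_one h0, jw, one, trace_of, Diagram.closureLoops, Nat.card_eq_zero.2, pow_zero]
    refine .inl ⟨fun q => ?_⟩
    induction q using Quotient.inductionOn with
    | h x => rcases x with x | x <;> exact x.elim0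
  | succ n ih =>
    have hn' := hN (n + 1) (by omega) hn
    rw [← trace_partialTrace, partialTrace_jw ht hn' (jw_comp_jw ht hN n (by omega)), map_smul,
      ih (by omega), smul_eq_mul, div_mul_cancel₀ _ hn']

theorem jw_comp_capRight (ht : t ≠ 0) (hN : ∀ k, 1 ≤ k → k ≤ N → quantumInt t k ≠ 0) (n : ℕ)
    (hn : n + 2 ≤ N) : comp (loopValue t) (jw t (n + 2)) (capRight K n) = 0 := by
  have h := congrArg flip (cupRight_comp_jw_of_idem ht (hN (n + 1) (by omega) (by omega))
    (hN (n + 2) (by omega) hn) (jw_comp_jw ht hN n (by omega)))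
  rwa [flip_comp, flip_cupRight, flip_jw, map_zero] at h

theorem jw_comp_tensor (ht : t ≠ 0) (hN : ∀ k, 1 ≤ k → k ≤ N → quantumInt t k ≠ 0) (n : ℕ)
    (hn : n ≤ N) : comp (loopValue t) (jw t (n + 1)) (tensor (jw t n) (one K 1)) =
      jw t (n + 1) := by
  have h := congrArg flip (jw_absorb (jw_comp_jw ht hN n hn))
  rwa [flip_comp, flip_tensor, flip_jw, flip_jw, flip_one] at h

theorem jw_comp_capAt (ht : t ≠ 0) (hN : ∀ k, 1 ≤ k → k ≤ N → quantumInt t k ≠ 0) (i j : ℕ)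
    (hn : i + 2 + j ≤ N) :
    comp (loopValue t) (jw t (i + 2 + j)) (Hom.of K (Diagram.capAt i j)) = 0 := by
  induction j with
  | zero =>
    refine Eq.trans ?_ (jw_comp_capRight ht hN i hn)
    refine congrArg _ ?_
    rw [capRight, one, tensor_of]
    exact congrArg (Hom.of K) (Diagram.tensor_zero _)
  | succ j ih =>
    have h : Hom.of K (Diagram.capAt i (j + 1)) =
        tensor (Hom.of K (Diagram.capAt i j)) (one K 1) := by
      rw [Diagram.capAt, Diagram.capAt, ← tensor_of _ (Diagram.identity (j + 1)),
        ← tensor_of _ (Diagram.identity j)]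
      exact tensor_one_succ (Hom.of K (Diagram.tensor (Diagram.identity i) Diagram.cap)) j
    rw [h]
    have h' : comp (loopValue t) (tensor (jw t (i + 2 + j)) (one K 1))
        (tensor (Hom.of K (Diagram.capAt i j)) (one K 1)) = 0 := by
      rw [tensor_comp, ih (by omega), map_zero, LinearMap.zero_apply]
    refine (congrArg (fun b => comp (loopValue t) b _)
      (jw_comp_tensor ht hN (i + 2 + j) (by omega)).symm).trans ?_
    rw [comp_assoc]
    exact (congrArg _ h').trans (map_zero _)

/-- Jones–Wenzl idempotents annihilate diagrams with two adjacent points that are joined. -/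
theorem jw_comp_of_adjacentAt (ht : t ≠ 0) (hN : ∀ k, 1 ≤ k → k ≤ N → quantumInt t k ≠ 0)
    {i j : ℕ} (a : Diagram m (i + 2 + j)) (ha : Diagram.AdjacentAt i j a) (hn : i + 2 + j ≤ N) :
    comp (loopValue t) (jw t (i + 2 + j)) (Hom.of K a) = 0 := by
  have h2 := hN 2 (by omega) (by omega)
  have hd : loopValue t ≠ 0 := by
    rwa [loopValue_eq ht (sub_inv_ne_zero_of_quantumInt h2)]
  obtain ⟨h3, h4⟩ := a.stack_capAt ha
  have h : loopValue t • Hom.of K a = comp (loopValue t) (Hom.of K (Diagram.capAt i j))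
      (comp (loopValue t) (Hom.of K (Diagram.capAt i j).flip) (Hom.of K a)) := by
    rw [comp_of, map_smul, comp_of, smul_smul, ← pow_add, h3, h4, pow_one]
  have h5 : loopValue t • comp (loopValue t) (jw t (i + 2 + j)) (Hom.of K a) = 0 := by
    rw [← map_smul, h, ← comp_assoc, jw_comp_capAt ht hN i j hn, map_zero, LinearMap.zero_apply]
  exact (smul_eq_zero.1 h5).resolve_left hd

/-- Only the identity diagram survives between two Jones–Wenzl idempotents. -/
theorem jw_comp_of_comp_jw (ht : t ≠ 0) (hN : ∀ k, 1 ≤ k → k ≤ N → quantumInt t k ≠ 0)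
    (a : Diagram m n) : m ≤ N → n ≤ N →
    comp (loopValue t) (jw t n) (comp (loopValue t) (Hom.of K a) (jw t m)) = 0 ∨
      (m = n ∧ a ≍ Diagram.identity n) := by
  induction a using Diagram.cases_adjacent with
  | hid n => exact fun _ _ => .inr ⟨rfl, HEq.rfl⟩
  | hbot m i j a ha =>
    intro _ hn
    rw [← comp_assoc, jw_comp_of_adjacentAt ht hN a ha hn, map_zero, LinearMap.zero_apply]
    exact .inl rfl
  | htop n i j a ha =>
    intro hm _
    have h := congrArg flip (jw_comp_of_adjacentAt ht hN a.flip ha hm)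
    rw [flip_comp, flip_of, Diagram.flip_flip, flip_jw, map_zero] at h
    rw [h, map_zero]
    exact .inl rfl

theorem jw_comp_comp_jw_of_ne (ht : t ≠ 0) (hN : ∀ k, 1 ≤ k → k ≤ N → quantumInt t k ≠ 0)
    (hm : m ≤ N) (hn : n ≤ N) (hmn : m ≠ n) (a : Hom K m n) :
    comp (loopValue t) (jw t n) (comp (loopValue t) a (jw t m)) = 0 := by
  induction a using hom_induction with
  | h0 => simp
  | hadd x y hx hy => simp [hx, hy]
  | hof c a =>
    rcases jw_comp_of_comp_jw ht hN a hm hn with h | h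
    · simp [h]
    · exact absurd h.1 hmn

theorem jw_comp_comp_jw (ht : t ≠ 0) (hN : ∀ k, 1 ≤ k → k ≤ N → quantumInt t k ≠ 0)
    (hn : n ≤ N) (a : Hom K n n) :
    ∃ c : K, comp (loopValue t) (jw t n) (comp (loopValue t) a (jw t n)) = c • jw t n := by
  induction a using hom_induction with
  | h0 => exact ⟨0, by simp⟩
  | hadd x y hx hy =>
    obtain ⟨c, hc⟩ := hx
    obtain ⟨c', hc'⟩ := hy
    exact ⟨c + c', by rw [map_add, LinearMap.add_apply, map_add, hc, hc', add_smul]⟩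
  | hof c a =>
    rcases jw_comp_of_comp_jw ht hN a hn hn with h | ⟨-, h⟩
    · exact ⟨0, by simp [h]⟩
    · rw [eq_of_heq h]
      refine ⟨c, ?_⟩
      have h1 := one_comp (d := loopValue t) (jw t n)
      rw [one] at h1
      rw [map_smul, LinearMap.smul_apply, map_smul, h1, jw_comp_jw ht hN n hn]

end JonesWenzl

/-! ### The ideal of negligible morphisms -/

section Negligible

variable {K : Type*} [Field K] {d : K} {k l m n : ℕ}

theorem trace_of_comp_of (a : Diagram m n) (c : Diagram n m) :
    trace d (comp d (Hom.of K a) (Hom.of K c)) =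
      d ^ (Diagram.loops c a + Diagram.closureLoops (Diagram.stack c a)) := by
  rw [comp_of, map_smul, trace_of, smul_eq_mul, pow_add]

theorem tensor_one_mem_negligible {a : Hom K m n} (ha : a ∈ negligible d m n) (k : ℕ) :
    tensor a (one K k) ∈ negligible d (m + k) (n + k) := by
  intro c
  induction c using hom_induction with
  | h0 => simp
  | hadd x y hx hy => simp [hx, hy]
  | hof z c =>
    obtain ⟨e, c', h⟩ := c.exists_partialTrace_right
    have key : ∀ b : Hom K m n, trace d (comp d (tensor b (one K k)) (Hom.of K c)) =
        d ^ e * trace d (comp d b (Hom.of K c')) := by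
      intro b
      induction b using hom_induction with
      | h0 => simp
      | hadd x y hx hy => simp only [map_add, LinearMap.add_apply, hx, hy, mul_add]
      | hof w b =>
        simp only [map_smul, LinearMap.smul_apply, smul_eq_mul]
        rw [one, tensor_of, trace_of_comp_of, trace_of_comp_of, h, pow_add d e]
        ring
    rw [map_smul, map_smul, key, ha, mul_zero, smul_zero]

theorem one_tensor_mem_negligible {a : Hom K m n} (ha : a ∈ negligible d m n) (k : ℕ) :
    tensor (one K k) a ∈ negligible d (k + m) (k + n) := by
  intro c
  induction c using hom_induction with
  | h0 => simp
  | hadd x y hx hy => simp [hx, hy]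
  | hof z c =>
    obtain ⟨e, c', h⟩ := c.exists_partialTrace_left
    have key : ∀ b : Hom K m n, trace d (comp d (tensor (one K k) b) (Hom.of K c)) =
        d ^ e * trace d (comp d b (Hom.of K c')) := by
      intro b
      induction b using hom_induction with
      | h0 => simp
      | hadd x y hx hy => simp only [map_add, LinearMap.add_apply, hx, hy, mul_add]
      | hof w b =>
        simp only [map_smul, LinearMap.smul_apply, smul_eq_mul]
        rw [one, tensor_of, trace_of_comp_of, trace_of_comp_of, h, pow_add d e]
        ring
    rw [map_smul, map_smul, key, ha, mul_zero, smul_zero]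

theorem comp_mem_negligible_left (b : Hom K m n) {a : Hom K l m} (ha : a ∈ negligible d l m) :
    comp d b a ∈ negligible d l n := by
  intro c
  rw [comp_assoc, trace_comp_comm, comp_assoc]
  exact ha _

theorem comp_mem_negligible_right {b : Hom K m n} (a : Hom K l m) (hb : b ∈ negligible d m n) :
    comp d b a ∈ negligible d l n := by
  intro c
  rw [comp_assoc]
  exact hb _

/-- The ideal of negligible morphisms. -/
noncomputable def negligibleIdeal (d : K) : TensorIdeal d where
  hom := negligible d
  comp_left b _ ha := comp_mem_negligible_left b ha
  comp_right _ a hb := comp_mem_negligible_right a hb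
  tensor_left {m n m' n'} a b hb := by
    have h : tensor a b = comp d (tensor a (one K n')) (tensor (one K m) b) := by
      rw [tensor_comp, comp_one, one_comp]
    rw [h]
    exact comp_mem_negligible_left _ (one_tensor_mem_negligible hb m)
  tensor_right {m n m' n'} a b ha := by
    have h : tensor a b = comp d (tensor (one K n) b) (tensor a (one K m')) := by
      rw [tensor_comp, comp_one, one_comp]
    rw [h]
    exact comp_mem_negligible_left _ (tensor_one_mem_negligible ha m')

theorem TensorIdeal.mem_generatedBy_self (p : Hom K m n) :
    p ∈ (TensorIdeal.generatedBy d p).hom m n := by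
  simp only [TensorIdeal.generatedBy, Submodule.mem_iInf]
  exact fun _ hJ => hJ

theorem TensorIdeal.generatedBy_le {p : Hom K k l} (J : TensorIdeal d) (hp : p ∈ J.hom k l) :
    (TensorIdeal.generatedBy d p).hom m n ≤ J.hom m n :=
  iInf₂_le J hp

end Negligible

/-! ### Negligible morphisms at a root of unity -/

section RootOfUnity

variable {K : Type*} [Field K] {t : K} {N m n : ℕ}

/-- All traces of `p_[N] b` are multiples of the trace `[N+1] = 0` of `p_[N]`. -/
theorem jw_mem_negligible (ht : t ≠ 0) (h0 : t - t⁻¹ ≠ 0)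
    (hN : ∀ k, 1 ≤ k → k ≤ N → quantumInt t k ≠ 0) (hN' : quantumInt t (N + 1) = 0) :
    jw t N ∈ negligible (loopValue t) N N := by
  intro b
  obtain ⟨c, hc⟩ := jw_comp_comp_jw ht hN le_rfl b
  rw [← jw_comp_jw ht hN N le_rfl, comp_assoc, trace_comp_comm, comp_assoc, hc, map_smul,
    trace_jw ht h0 hN N le_rfl, hN', smul_zero]

/-- The morphisms that are, modulo the ideal `J`, sums of morphisms that factor through the
Jones–Wenzl idempotents on less than `N` strands. -/
noncomputable def factorSpan (t : K) (N : ℕ) (J : TensorIdeal (loopValue t)) (m n : ℕ) :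
    Submodule K (Hom K m n) :=
  J.hom m n ⊔ Submodule.span K {x | ∃ k < N, ∃ (f : Hom K k n) (g : Hom K m k),
    x = comp (loopValue t) f (comp (loopValue t) (jw t k) g)}

theorem factorSpan_le {J : TensorIdeal (loopValue t)} {S : Submodule K (Hom K m n)}
    (hJ : J.hom m n ≤ S) (hjw : ∀ k < N, ∀ (f : Hom K k n) (g : Hom K m k),
      comp (loopValue t) f (comp (loopValue t) (jw t k) g) ∈ S) : factorSpan t N J m n ≤ S := by
  refine sup_le hJ (Submodule.span_le.2 ?_)
  rintro _ ⟨k, hk, f, g, rfl⟩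
  exact hjw k hk f g

theorem comp_jw_comp_mem_factorSpan (J : TensorIdeal (loopValue t)) {k : ℕ} (hk : k < N)
    (f : Hom K k n) (g : Hom K m k) :
    comp (loopValue t) f (comp (loopValue t) (jw t k) g) ∈ factorSpan t N J m n :=
  Submodule.mem_sup_right (Submodule.subset_span ⟨k, hk, f, g, rfl⟩)

theorem comp_comp_mem_factorSpan {J : TensorIdeal (loopValue t)} {m' n' : ℕ} {x : Hom K m n}
    (hx : x ∈ factorSpan t N J m n) (f : Hom K n n') (g : Hom K m' m) :
    comp (loopValue t) f (comp (loopValue t) x g) ∈ factorSpan t N J m' n' := by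
  refine factorSpan_le (S := (factorSpan t N J m' n').comap
    (comp (loopValue t) f ∘ₗ (comp (loopValue t)).flip g)) ?_ ?_ hx
  · exact fun x hx => Submodule.mem_sup_left (J.comp_left _ _ (J.comp_right _ _ hx))
  · intro k hk f' g'
    change comp (loopValue t) f (comp (loopValue t) _ g) ∈ factorSpan t N J m' n'
    rw [comp_assoc, comp_assoc, ← comp_assoc f]
    exact comp_jw_comp_mem_factorSpan J hk _ _

/-- Wenzl's recursion decomposes `p_[k] ⊗ 1` into `p_[k+1]` and a multiple of a morphism that
factors through `p_[k-1]`. -/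
theorem jw_tensor_one_mem_factorSpan (ht : t ≠ 0)
    (hN : ∀ k, 1 ≤ k → k ≤ N → quantumInt t k ≠ 0) (h2 : 2 ≤ N) {J : TensorIdeal (loopValue t)}
    (hJ : jw t N ∈ J.hom N N) {k : ℕ} (hk : k < N) :
    tensor (jw t k) (one K 1) ∈ factorSpan t N J (k + 1) (k + 1) := by
  have hjw : ∀ i ≤ N, jw t i ∈ factorSpan t N J i i := by
    intro i hi
    rcases hi.eq_or_lt with rfl | hi
    · exact Submodule.mem_sup_left hJ
    · have := comp_jw_comp_mem_factorSpan J hi (one K i) (one K i)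
      rwa [comp_one, one_comp] at this
  match k, hk with
  | 0, hk =>
    have h : tensor (jw t 0) (one K 1) = jw t 1 := tensor_one_one (m := 0) (n := 1)
    rw [h]
    exact hjw 1 (by omega)
  | k + 1, hk =>
    have hrec : tensor (jw t (k + 1)) (one K 1) = jw t (k + 2) +
        (quantumInt t (k + 1) / quantumInt t (k + 2)) •
        comp (loopValue t) (tensor (jw t (k + 1)) (one K 1))
        (comp (loopValue t) (comp (loopValue t) (capRight K k) (cupRight K k))
          (tensor (jw t (k + 1)) (one K 1))) := by
      conv_rhs => enter [1]; rw [jw]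
      rw [sub_add_cancel]
    have habs : comp (loopValue t) (cupRight K k) (tensor (jw t (k + 1)) (one K 1)) =
        comp (loopValue t) (jw t k) (comp (loopValue t) (cupRight K k)
          (tensor (jw t (k + 1)) (one K 1))) := by
      have h : comp (loopValue t) (tensor (jw t k) (one K 2))
          (tensor (jw t (k + 1)) (one K 1)) = tensor (jw t (k + 1)) (one K 1) := by
        rw [tensor_one_succ (jw t k) 1]
        refine (tensor_comp _ _ _ _).trans ?_
        rw [one_comp, jw_absorb (jw_comp_jw ht hN k (by omega))]
      rw [← comp_assoc, ← cupRight_comp_tensor, comp_assoc, h]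
    have hmem : tensor (jw t (k + 1)) (one K 1) ∈ factorSpan t N J (k + 2) (k + 2) := by
      rw [hrec]
      refine Submodule.add_mem _ (hjw (k + 2) hk) (Submodule.smul_mem _ _ ?_)
      rw [comp_assoc, habs, ← comp_assoc (tensor (jw t (k + 1)) (one K 1))]
      exact comp_jw_comp_mem_factorSpan J (by omega) _ _
    exact hmem

/-- Modulo an ideal that contains `p_[N]`, each identity factors through the Jones–Wenzl
idempotents on less than `N` strands. -/
theorem one_mem_factorSpan (ht : t ≠ 0)
    (hN : ∀ k, 1 ≤ k → k ≤ N → quantumInt t k ≠ 0) (h2 : 2 ≤ N) {J : TensorIdeal (loopValue t)}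
    (hJ : jw t N ∈ J.hom N N) (n : ℕ) : one K n ∈ factorSpan t N J n n := by
  induction n with
  | zero =>
    have := comp_jw_comp_mem_factorSpan (t := t) J (k := 0) (N := N) (by omega) (one K 0) (one K 0)
    rwa [comp_one, one_comp] at this
  | succ n ih =>
    rw [← tensor_one_one]
    refine factorSpan_le (S := (factorSpan t N J (n + 1) (n + 1)).comap
      (tensor.flip (one K 1))) ?_ ?_ ih
    · exact fun x hx => Submodule.mem_sup_left (J.tensor_right _ _ hx)
    · intro k hk f g
      change tensor _ (one K 1) ∈ factorSpan t N J (n + 1) (n + 1)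
      have h : tensor (comp (loopValue t) f (comp (loopValue t) (jw t k) g)) (one K 1) =
          comp (loopValue t) (tensor f (one K 1)) (comp (loopValue t)
            (tensor (jw t k) (one K 1)) (tensor g (one K 1))) := by
        rw [tensor_comp, tensor_comp, one_comp, one_comp]
      rw [h]
      exact comp_comp_mem_factorSpan (jw_tensor_one_mem_factorSpan ht hN h2 hJ hk) _ _

/-- Between Jones–Wenzl idempotents of non-zero trace there are no non-zero negligible
morphisms. -/
theorem jw_comp_comp_jw_eq_zero (ht : t ≠ 0) (h0 : t - t⁻¹ ≠ 0)
    (hN : ∀ k, 1 ≤ k → k ≤ N → quantumInt t k ≠ 0) (hm : m < N) (hn : n < N) {x : Hom K m n}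
    (hx : x ∈ negligible (loopValue t) m n) :
    comp (loopValue t) (jw t n) (comp (loopValue t) x (jw t m)) = 0 := by
  by_cases hmn : m = n
  · subst hmn
    obtain ⟨c, hc⟩ := jw_comp_comp_jw ht hN hm.le x
    have hneg := comp_mem_negligible_left (jw t m) (comp_mem_negligible_right (jw t m) hx)
      (one K m)
    rw [comp_one, hc, map_smul, trace_jw ht h0 hN m hm.le, smul_eq_mul] at hneg
    rw [hc, (mul_eq_zero.1 hneg).resolve_right (hN (m + 1) (by omega) hm), zero_smul]
  · exact jw_comp_comp_jw_of_ne ht hN hm.le hn.le hmn x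

/-- Writing `a = 1 a 1` and decomposing both identities modulo `J` leaves terms that contain
`p_[k] (g a f') p_[k'] = 0`. -/
theorem negligible_le (ht : t ≠ 0) (h0 : t - t⁻¹ ≠ 0)
    (hN : ∀ k, 1 ≤ k → k ≤ N → quantumInt t k ≠ 0) (h2 : 2 ≤ N) {J : TensorIdeal (loopValue t)}
    (hJ : jw t N ∈ J.hom N N) : negligible (loopValue t) m n ≤ J.hom m n := by
  intro a ha
  have key : ∀ x ∈ factorSpan t N J n n, ∀ y ∈ factorSpan t N J m m,
      comp (loopValue t) x (comp (loopValue t) a y) ∈ J.hom m n := by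
    intro x hx y hy
    refine factorSpan_le (S := (J.hom m n).comap
      ((comp (loopValue t)).flip (comp (loopValue t) a y))) ?_ ?_ hx
    · exact fun x hx => J.comp_right _ _ hx
    · intro k hk f g
      refine factorSpan_le (S := (J.hom m n).comap
        (comp (loopValue t) (comp (loopValue t) f (comp (loopValue t) (jw t k) g)) ∘ₗ
          comp (loopValue t) a)) ?_ ?_ hy
      · exact fun y hy => J.comp_left _ _ (J.comp_left _ _ hy)
      intro k' hk' f' g'
      change comp (loopValue t) _ (comp (loopValue t) a _) ∈ J.hom m n
      have hz := jw_comp_comp_jw_eq_zero ht h0 hN hk' hk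
        (comp_mem_negligible_left g (comp_mem_negligible_right f' ha))
      have h : comp (loopValue t) (comp (loopValue t) f (comp (loopValue t) (jw t k) g))
          (comp (loopValue t) a
            (comp (loopValue t) f' (comp (loopValue t) (jw t k') g'))) =
          comp (loopValue t) f (comp (loopValue t) (comp (loopValue t) (jw t k)
            (comp (loopValue t) (comp (loopValue t) g (comp (loopValue t) a f')) (jw t k')))
            g') := by
        simp only [comp_assoc]
      rw [h, hz, map_zero, LinearMap.zero_apply, map_zero]
      exact Submodule.zero_mem _
  have := key _ (one_mem_factorSpan ht hN h2 hJ n) _ (one_mem_factorSpan ht hN h2 hJ m)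
  rwa [one_comp, comp_one] at this

end RootOfUnity

/-! ### Specialization -/

section Specialization

variable {τ : ℂ} {l m n : ℕ}

/-- The rational function `f` has no pole at `τ` and takes the value `z` there. -/
def SpecializesTo (τ : ℂ) (f : RatFunc ℂ) (z : ℂ) : Prop :=
  f.denom.eval τ ≠ 0 ∧ f.eval (RingHom.id ℂ) τ = z

namespace SpecializesTo

variable {f g : RatFunc ℂ} {z w : ℂ}

/-- A rational function has no pole where a multiple of its denominator does not vanish. -/
theorem of_dvd {p : Polynomial ℂ} (hp : p.eval τ ≠ 0) (h : f.denom ∣ p) :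
    f.denom.eval τ ≠ 0 := by
  obtain ⟨q, rfl⟩ := h
  rw [Polynomial.eval_mul] at hp
  exact left_ne_zero_of_mul hp

theorem add (hf : SpecializesTo τ f z) (hg : SpecializesTo τ g w) :
    SpecializesTo τ (f + g) (z + w) := by
  refine ⟨of_dvd ?_ (RatFunc.denom_add_dvd f g), ?_⟩
  · rw [Polynomial.eval_mul]; exact mul_ne_zero hf.1 hg.1
  · rw [RatFunc.eval_add (RingHom.id ℂ) τ (by simpa using hf.1) (by simpa using hg.1), hf.2, hg.2]

theorem mul (hf : SpecializesTo τ f z) (hg : SpecializesTo τ g w) :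
    SpecializesTo τ (f * g) (z * w) := by
  refine ⟨of_dvd ?_ (RatFunc.denom_mul_dvd f g), ?_⟩
  · rw [Polynomial.eval_mul]; exact mul_ne_zero hf.1 hg.1
  · rw [RatFunc.eval_mul (RingHom.id ℂ) τ (by simpa using hf.1) (by simpa using hg.1), hf.2, hg.2]

theorem const (c : ℂ) : SpecializesTo τ (RatFunc.C c) c := by
  constructor <;> simp

theorem zero : SpecializesTo τ 0 0 := by
  constructor <;> simp

theorem one : SpecializesTo τ 1 1 := by
  constructor <;> simp

theorem X : SpecializesTo τ RatFunc.X τ := by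
  constructor <;> simp

theorem neg (hf : SpecializesTo τ f z) : SpecializesTo τ (-f) (-z) := by
  have := (const (-1)).mul hf
  rwa [map_neg, map_one, neg_one_mul, neg_one_mul] at this

theorem sub (hf : SpecializesTo τ f z) (hg : SpecializesTo τ g w) :
    SpecializesTo τ (f - g) (z - w) := by
  rw [sub_eq_add_neg, sub_eq_add_neg]
  exact hf.add hg.neg

theorem pow (hf : SpecializesTo τ f z) (k : ℕ) : SpecializesTo τ (f ^ k) (z ^ k) := by
  induction k with
  | zero => simpa using one
  | succ k ih => rw [pow_succ, pow_succ]; exact ih.mul hf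

theorem inv (hf : SpecializesTo τ f z) (hz : z ≠ 0) : SpecializesTo τ f⁻¹ z⁻¹ := by
  have hf0 : f ≠ 0 := by
    rintro rfl
    exact hz (by simpa using hf.2.symm)
  have hnum : f.num.eval τ ≠ 0 := by
    intro h
    refine hz (hf.2.symm.trans ?_)
    rw [RatFunc.eval, Polynomial.eval₂_id, h, zero_div]
  have hden := of_dvd hnum (RatFunc.denom_inv_dvd hf0)
  refine ⟨hden, ?_⟩
  have h := RatFunc.eval_mul (f := RingHom.id ℂ) (a := τ) (x := f) (y := f⁻¹)
    (by simpa using hf.1) (by simpa using hden)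
  rw [mul_inv_cancel₀ hf0, RatFunc.eval_one, hf.2] at h
  exact eq_inv_of_mul_eq_one_right h.symm

theorem div (hf : SpecializesTo τ f z) (hg : SpecializesTo τ g w) (hw : w ≠ 0) :
    SpecializesTo τ (f / g) (z / w) := by
  rw [div_eq_mul_inv, div_eq_mul_inv]
  exact hf.mul (hg.inv hw)

theorem sum {ι : Type*} (s : Finset ι) {f : ι → RatFunc ℂ} {z : ι → ℂ}
    (h : ∀ i, SpecializesTo τ (f i) (z i)) :
    SpecializesTo τ (∑ i ∈ s, f i) (∑ i ∈ s, z i) := by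
  classical
  induction s using Finset.induction_on with
  | empty => simpa using zero
  | insert i s hi ih =>
    rw [Finset.sum_insert hi, Finset.sum_insert hi]
    exact (h i).add ih

theorem quantumInt (hτ : τ ≠ 0) (h0 : τ - τ⁻¹ ≠ 0) (k : ℕ) :
    SpecializesTo τ (TemperleyLieb.quantumInt RatFunc.X k) (TemperleyLieb.quantumInt τ k) :=
  ((X.pow k).sub ((X.inv hτ).pow k)).div (X.sub (X.inv hτ)) h0

theorem loopValue (hτ : τ ≠ 0) :
    SpecializesTo τ (TemperleyLieb.loopValue RatFunc.X) (TemperleyLieb.loopValue τ) :=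
  X.add (X.inv hτ)

end SpecializesTo

instance : Finite (Diagram m n) :=
  Finite.of_injective (fun (a : Diagram m n) u v => a.rel u v)
    fun _ _ h => Diagram.ext (Setoid.ext fun u v => iff_of_eq (congrFun (congrFun h u) v))

/-- The coefficients of the morphism `f` over `ℂ(t)` have no pole at `τ`, and take the values given
by `g` there. -/
def Hom.SpecializesTo (τ : ℂ) (f : Hom (RatFunc ℂ) m n) (g : Hom ℂ m n) : Prop :=
  ∀ a, TemperleyLieb.SpecializesTo τ (f a) (g a)

namespace Hom.SpecializesTo

theorem evaluable {f : Hom (RatFunc ℂ) m n} {g : Hom ℂ m n} (h : SpecializesTo τ f g) :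
    Evaluable τ f := fun a => (h a).1

theorem evalAt_eq {f : Hom (RatFunc ℂ) m n} {g : Hom ℂ m n} (h : SpecializesTo τ f g) :
    evalAt τ f = g := by
  ext a
  rw [evalAt, Finsupp.mapRange_apply]
  exact (h a).2

theorem of (a : Diagram m n) : SpecializesTo τ (Hom.of _ a) (Hom.of _ a) := by
  classical
  intro b
  rw [Hom.of, Hom.of, Finsupp.single_apply, Finsupp.single_apply]
  split_ifs
  · exact .one
  · exact .zero

theorem sub {f f' : Hom (RatFunc ℂ) m n} {g g' : Hom ℂ m n} (h : SpecializesTo τ f g)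
    (h' : SpecializesTo τ f' g') : SpecializesTo τ (f - f') (g - g') :=
  fun a => (h a).sub (h' a)

theorem smul {c : RatFunc ℂ} {z : ℂ} (hc : TemperleyLieb.SpecializesTo τ c z)
    {f : Hom (RatFunc ℂ) m n} {g : Hom ℂ m n} (h : SpecializesTo τ f g) :
    SpecializesTo τ (c • f) (z • g) :=
  fun a => hc.mul (h a)

theorem sum {ι : Type*} (s : Finset ι) {f : ι → Hom (RatFunc ℂ) m n} {g : ι → Hom ℂ m n}
    (h : ∀ i, SpecializesTo τ (f i) (g i)) : SpecializesTo τ (∑ i ∈ s, f i) (∑ i ∈ s, g i) := by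
  intro a
  rw [Finsupp.finsetSum_apply, Finsupp.finsetSum_apply]
  exact .sum s fun i => h i a

theorem sum_smul_of {K : Type*} [Field K] [Fintype (Diagram m n)] (f : Hom K m n) :
    ∑ a, f a • Hom.of K a = f := by
  conv_rhs => rw [← Finsupp.univ_sum_single f]
  simp [Hom.of]

/-- Bilinear maps specialize if they do so on diagrams. -/
theorem map₂ {m' n' m'' n'' : ℕ}
    {B : Hom (RatFunc ℂ) m n →ₗ[RatFunc ℂ] Hom (RatFunc ℂ) m' n' →ₗ[RatFunc ℂ]
      Hom (RatFunc ℂ) m'' n''}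
    {B' : Hom ℂ m n →ₗ[ℂ] Hom ℂ m' n' →ₗ[ℂ] Hom ℂ m'' n''}
    (hB : ∀ a b, SpecializesTo τ (B (Hom.of _ a) (Hom.of _ b)) (B' (Hom.of _ a) (Hom.of _ b)))
    {f : Hom (RatFunc ℂ) m n} {g : Hom ℂ m n} (h : SpecializesTo τ f g)
    {f' : Hom (RatFunc ℂ) m' n'} {g' : Hom ℂ m' n'} (h' : SpecializesTo τ f' g') :
    SpecializesTo τ (B f f') (B' g g') := by
  have := Fintype.ofFinite (Diagram m n)
  have := Fintype.ofFinite (Diagram m' n')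
  rw [← sum_smul_of f, ← sum_smul_of f', ← sum_smul_of g, ← sum_smul_of g']
  simp only [map_sum, LinearMap.sum_apply, map_smul, LinearMap.smul_apply]
  exact .sum _ fun b => .smul (h' b) (.sum _ fun a => .smul (h a) (hB a b))

theorem comp (hτ : τ ≠ 0) {f : Hom (RatFunc ℂ) m n} {g : Hom ℂ m n} (h : SpecializesTo τ f g)
    {f' : Hom (RatFunc ℂ) l m} {g' : Hom ℂ l m} (h' : SpecializesTo τ f' g') :
    SpecializesTo τ (TemperleyLieb.comp (loopValue RatFunc.X) f f')
      (TemperleyLieb.comp (loopValue τ) g g') := by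
  refine map₂ (fun a b => ?_) h h'
  rw [comp_of, comp_of]
  exact smul ((SpecializesTo.loopValue hτ).pow _) (of _)

theorem tensor {m' n' : ℕ} {f : Hom (RatFunc ℂ) m n} {g : Hom ℂ m n} (h : SpecializesTo τ f g)
    {f' : Hom (RatFunc ℂ) m' n'} {g' : Hom ℂ m' n'} (h' : SpecializesTo τ f' g') :
    SpecializesTo τ (TemperleyLieb.tensor f f') (TemperleyLieb.tensor g g') := by
  refine map₂ (fun a b => ?_) h h'
  rw [tensor_of, tensor_of]
  exact of _

theorem jw (hτ : τ ≠ 0) {N : ℕ} (hN : ∀ k, 1 ≤ k → k ≤ N → quantumInt τ k ≠ 0) (n : ℕ)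
    (hn : n ≤ N) : SpecializesTo τ (TemperleyLieb.jw RatFunc.X n) (TemperleyLieb.jw τ n) := by
  induction n using TemperleyLieb.jw.induct with
  | case1 => exact of _
  | case2 => exact of _
  | case3 n ih =>
    have hn' := hN (n + 2) (by omega) hn
    have h0 := sub_inv_ne_zero_of_quantumInt hn'
    have hP := (ih (by omega)).tensor (of (τ := τ) (Diagram.identity 1))
    have hcap := (of (τ := τ) (Diagram.identity n)).tensor (of Diagram.cap)
    have hcup := (of (τ := τ) (Diagram.identity n)).tensor (of Diagram.cup)
    rw [TemperleyLieb.jw, TemperleyLieb.jw]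
    have hc := (SpecializesTo.quantumInt hτ h0 (n + 1)).div (SpecializesTo.quantumInt hτ h0 _) hn'
    exact hP.sub (smul hc (comp hτ hP (comp hτ (comp hτ hcap hcup) hP)))

end Hom.SpecializesTo

end Specialization

theorem quantumInt_eq_zero_iff {K : Type*} [Field K] {t : K} (ht : t ≠ 0) (h0 : t - t⁻¹ ≠ 0)
    (k : ℕ) : quantumInt t k = 0 ↔ (t ^ 2) ^ k = 1 := by
  rw [quantumInt, div_eq_zero_iff, or_iff_left h0, sub_eq_zero, inv_pow,
    ← mul_eq_one_iff_eq_inv₀ (pow_ne_zero k ht), ← pow_mul, two_mul, pow_add]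

end TemperleyLieb

open TemperleyLieb in
theorem mainTheorem2 (τ : ℂ) (ℓ : ℕ) (hℓ : 3 ≤ ℓ) (hτ : IsPrimitiveRoot (τ ^ 2) ℓ) :
    TemperleyLieb.Evaluable τ (TemperleyLieb.jonesWenzl (ℓ - 1)) ∧
    TemperleyLieb.comp (TemperleyLieb.loopValue τ)
        (TemperleyLieb.evalAt τ (TemperleyLieb.jonesWenzl (ℓ - 1)))
        (TemperleyLieb.evalAt τ (TemperleyLieb.jonesWenzl (ℓ - 1))) =
      TemperleyLieb.evalAt τ (TemperleyLieb.jonesWenzl (ℓ - 1)) ∧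
    ∀ m n : ℕ,
      (TemperleyLieb.TensorIdeal.generatedBy (TemperleyLieb.loopValue τ)
          (TemperleyLieb.evalAt τ (TemperleyLieb.jonesWenzl (ℓ - 1)))).hom m n =
        TemperleyLieb.negligible (TemperleyLieb.loopValue τ) m n := by
  have ht : τ ≠ 0 := by
    rintro rfl
    exact hτ.ne_zero (by omega) (by simp)
  have h0 : τ - τ⁻¹ ≠ 0 := by
    intro h
    refine hτ.ne_one (by omega) ?_
    rw [sub_eq_zero] at h
    rw [pow_two]
    nth_rewrite 2 [h]
    exact mul_inv_cancel₀ ht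
  have hN : ∀ k, 1 ≤ k → k ≤ ℓ - 1 → TemperleyLieb.quantumInt τ k ≠ 0 := fun k h1 h2 h =>
    hτ.pow_ne_one_of_pos_of_lt (by omega) (by omega) ((quantumInt_eq_zero_iff ht h0 k).1 h)
  have hN' : TemperleyLieb.quantumInt τ (ℓ - 1 + 1) = 0 := by
    rw [quantumInt_eq_zero_iff ht h0, Nat.sub_add_cancel (by omega)]
    exact hτ.pow_eq_one
  have hspec := Hom.SpecializesTo.jw ht hN (ℓ - 1) le_rfl
  rw [jonesWenzl_eq_jw, hspec.evalAt_eq]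
  refine ⟨hspec.evaluable, jw_comp_jw ht hN _ le_rfl, fun m n => le_antisymm ?_ ?_⟩
  · exact TensorIdeal.generatedBy_le (negligibleIdeal _) (jw_mem_negligible ht h0 hN hN')
  · exact negligible_le ht h0 hN (by omega) (TensorIdeal.mem_generatedBy_self _)
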